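/- For $f,g:\mathbb F_2^n\to\mathbb F_2$ let $\mathrm{dist}(f,g)=\Pr_{x\in\mathbb F_2^n}[f(x)\ne g(x)]$, and let $RM(n,d)$ be the Reed–Muller code, i.e. the set of all functions $\mathbb F_2^n\to\mathbb F_2$ that are evaluations of polynomials in $n$ variables over $\mathbb F_2$ of total degree at most $d$. **Theorem (List-decoding algorithm).** There is an algorithm (a single deterministic program) that, given $n$, $d$, a received word $R:\mathbb F_2^n\to\mathbb F_2$ (as a truth table) and a distance parameter $\alpha$ (in the form of the integer $\lfloor \alpha 2^n\rfloor$, the permitted number of disagreements), has the following property. Let $1\le \ell\le d-1$ be integers and let $\epsilon>0$. Then for all $n$, all $\alpha\in[2^{\ell-d-1},\,2^{\ell-d}-\epsilon]$ and all $R:\mathbb F_2^n\to\mathbb F_2$, the algorithm produces a list of all $p\in RM(n,d)$ such that $\mathrm{dist}(p,R)\le\alpha$ (as truth tables, and nothing else), and it runs in time $\mathrm{poly}(2^{\Theta(n^\ell)})$. That is, there are a polynomial $P$ and, for all such $d,\ell,\epsilon$, a function $g(n)=\Theta(n^\ell)$ (as $n\to\infty$, with constants depending only on $d,\ell,\epsilon$)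 such that the running time is at most $P(2^{g(n)})$. Running time is counted in the following model, which is polynomially equivalent to Turing machines. A program is a finite list of mutually recursive first-order functions on binary trees, built from variables, $\mathrm{nil}$, $\mathrm{cons}$, let-bindings, case distinction between $\mathrm{nil}$ and $\mathrm{cons}$, and function calls. Every evaluation of an expression node counts as one step. -/

import Mathlib

open Filter Asymptotics

namespace ReedMuller

/-! ## The code -/

/-- The received words / codewords: functions `𝔽₂ⁿ → 𝔽₂`. -/
abbrev Word (n : ℕ) : Type := (Fin n → ZMod 2) → ZMod 2

/-- `RM(n,d)`: evaluations of `n`-variate polynomials over `𝔽₂` of total degree at most `d`. -/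
def RM (n d : ℕ) : Set (Word n) :=
  {f | ∃ q : MvPolynomial (Fin n) (ZMod 2), q.totalDegree ≤ d ∧ ∀ x, f x = MvPolynomial.eval x q}

/-- Relative distance: the fraction of points of `𝔽₂ⁿ` at which `f` and `g` differ. -/
noncomputable def relDist {n : ℕ} (f g : Word n) : ℝ := (hammingDist f g : ℝ) / 2 ^ n

/-- The ball `B(f,α)` of codewords of `RM(n,d)` at relative distance at most `α` from `f`. -/
def ball {n : ℕ} (d : ℕ) (f : Word n) (α : ℝ) : Set (Word n) :=
  {p | p ∈ RM n d ∧ relDist p f ≤ α}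

/-! ## The model of computation

First-order recursive programs (pure LISP): data are binary trees built from `nil` and `cons`, a
program is a finite list of mutually recursive function bodies, each with one argument, and the
running time is the number of expressions that are evaluated (every occurrence of a variable, `nil`,
`cons`, `let`, case distinction or function call costs one step each time that it is evaluated).
Every such step takes constant time on a machine with pointers, so that running times agree, up to
polynomial factors, with those of Turing machines and random access machines. -/

/-- Binary trees, the only data type of the programs. -/
inductive Data : Type where
  | nil : Data
  | cons (a b : Data) : Data

/-- Expressions; variables are de Bruijn indices into the environment (innermost binding first). -/
inductive Expr : Type where
  /-- the value of the variable with index `i` -/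
  | var (i : ℕ) : Expr
  /-- the constant `nil` -/
  | nil : Expr
  /-- pairing -/
  | cons (e₁ e₂ : Expr) : Expr
  /-- `let x := e₁ in e₂`; in `e₂` the variable `x` has index `0` -/
  | letIn (e₁ e₂ : Expr) : Expr
  /-- `match e with nil => e₁ | cons a b => e₂`; in `e₂`, `a` has index `0` and `b` has index `1` -/
  | caseOf (e e₁ e₂ : Expr) : Expr
  /-- call of the function number `f` of the program on the value of `e` -/
  | call (f : ℕ) (e : Expr) : Expr

/-- A program: the finite list of its function bodies. Function number `0` is the main one. -/
abbrev Program : Type := List Expr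

/-- `Eval P env e v t`: in program `P`, the evaluation of `e` in the environment `env` terminates
with value `v` after exactly `t` steps. -/
inductive Eval (P : Program) : List Data → Expr → Data → ℕ → Prop where
  | var {env : List Data} {i : ℕ} {v : Data} (h : env[i]? = some v) : Eval P env (.var i) v 1
  | nil {env : List Data} : Eval P env .nil .nil 1
  | cons {env : List Data} {e₁ e₂ : Expr} {v₁ v₂ : Data} {t₁ t₂ : ℕ}
      (h₁ : Eval P env e₁ v₁ t₁) (h₂ : Eval P env e₂ v₂ t₂) :
      Eval P env (.cons e₁ e₂) (.cons v₁ v₂) (t₁ + t₂ + 1)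
  | letIn {env : List Data} {e₁ e₂ : Expr} {v₁ v₂ : Data} {t₁ t₂ : ℕ}
      (h₁ : Eval P env e₁ v₁ t₁) (h₂ : Eval P (v₁ :: env) e₂ v₂ t₂) :
      Eval P env (.letIn e₁ e₂) v₂ (t₁ + t₂ + 1)
  | caseNil {env : List Data} {e e₁ e₂ : Expr} {v : Data} {t s : ℕ}
      (h : Eval P env e .nil t) (h₁ : Eval P env e₁ v s) :
      Eval P env (.caseOf e e₁ e₂) v (t + s + 1)
  | caseCons {env : List Data} {e e₁ e₂ : Expr} {a b v : Data} {t s : ℕ}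
      (h : Eval P env e (.cons a b) t) (h₂ : Eval P (a :: b :: env) e₂ v s) :
      Eval P env (.caseOf e e₁ e₂) v (t + s + 1)
  | call {env : List Data} {f : ℕ} {e body : Expr} {v w : Data} {t s : ℕ}
      (h : Eval P env e v t) (hf : P[f]? = some body) (hb : Eval P [v] body w s) :
      Eval P env (.call f e) w (t + s + 1)

/-- Programs are deterministic: value and number of steps are determined by the expression. -/
theorem Eval.det {P : Program} {env : List Data} {e : Expr} {v : Data} {t : ℕ}
    (h : Eval P env e v t) : ∀ {w : Data} {s : ℕ}, Eval P env e w s → v = w ∧ t = s := by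
  induction h with
  | var h =>
    intro w s h'
    cases h' with
    | var h2 => rw [h] at h2; exact ⟨Option.some.inj h2, rfl⟩
  | nil => intro w s h'; cases h'; exact ⟨rfl, rfl⟩
  | cons _ _ ih₁ ih₂ =>
    intro w s h'
    cases h' with
    | cons a b =>
      obtain ⟨rfl, rfl⟩ := ih₁ a
      obtain ⟨rfl, rfl⟩ := ih₂ b
      exact ⟨rfl, rfl⟩
  | letIn _ _ ih₁ ih₂ =>
    intro w s h'
    cases h' with
    | letIn a b =>
      obtain ⟨rfl, rfl⟩ := ih₁ a
      obtain ⟨rfl, rfl⟩ := ih₂ b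
      exact ⟨rfl, rfl⟩
  | caseNil _ _ ih₁ ih₂ =>
    intro w s h'
    cases h' with
    | caseNil a b =>
      obtain ⟨_, rfl⟩ := ih₁ a
      obtain ⟨rfl, rfl⟩ := ih₂ b
      exact ⟨rfl, rfl⟩
    | caseCons a b => exact Data.noConfusion (ih₁ a).1
  | caseCons _ _ ih₁ ih₂ =>
    intro w s h'
    cases h' with
    | caseNil a b => exact Data.noConfusion (ih₁ a).1
    | caseCons a b =>
      obtain ⟨h1, rfl⟩ := ih₁ a
      cases h1
      obtain ⟨rfl, rfl⟩ := ih₂ b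
      exact ⟨rfl, rfl⟩
  | call _ hf _ ih₁ ih₂ =>
    intro w s h'
    cases h' with
    | call a hg b =>
      obtain ⟨rfl, rfl⟩ := ih₁ a
      rw [hf] at hg
      cases hg
      obtain ⟨rfl, rfl⟩ := ih₂ b
      exact ⟨rfl, rfl⟩

/-- On input `x` the program `P` (that is, its main function) halts after exactly `t` steps with
output `y`. -/
def Program.HaltsWith (P : Program) (x y : Data) (t : ℕ) : Prop :=
  ∃ body : Expr, P[0]? = some body ∧ Eval P [x] body y t

/-! ## Encodings -/

/-- Natural numbers in unary. -/
def encodeNat : ℕ → Data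
  | 0 => .nil
  | k + 1 => .cons .nil (encodeNat k)

/-- Bits: `0` is `nil`, `1` is `cons nil nil`. -/
def encodeBit (b : ZMod 2) : Data := if b = 0 then .nil else .cons .nil .nil

/-- Lists of data. -/
def encodeList : List Data → Data
  | [] => .nil
  | a :: l => .cons a (encodeList l)

/-- The truth table of `f : 𝔽₂ⁿ → 𝔽₂`, as the complete binary tree of depth `n` whose `2ⁿ` leaves
carry the values of `f` at all the points of `𝔽₂ⁿ` in lexicographic order. -/
def encodeWord : {n : ℕ} → Word n → Data
  | 0, f => encodeBit (f Fin.elim0)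
  | _ + 1, f => .cons (encodeWord fun x => f (Fin.cons 0 x)) (encodeWord fun x => f (Fin.cons 1 x))

/-- The input of a list-decoding algorithm: `n`, `d`, the permitted number `⌊α 2ⁿ⌋` of
disagreements (the form in which the distance parameter `α` is given) and the received word. -/
noncomputable def decodingInput (n d : ℕ) (α : ℝ) (R : Word n) : Data :=
  .cons (encodeNat n) (.cons (encodeNat d) (.cons (encodeNat ⌊α * 2 ^ n⌋₊) (encodeWord R)))

/-- On received word `R` and distance parameter `α`, the program `A` halts after exactly `t` steps,
and its output is a list of the truth tables of all the codewords of `RM(n,d)` at relative distance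
at most `α` from `R`, and of nothing else. -/
def ListDecodesIn (A : Program) (n d : ℕ) (α : ℝ) (R : Word n) (t : ℕ) : Prop :=
  ∃ L : List (Word n), (∀ p : Word n, p ∈ L ↔ p ∈ ball d R α) ∧
    A.HaltsWith (decodingInput n d α R) (encodeList (L.map encodeWord)) t

end ReedMuller

namespace ReedMuller

/-! ## Words, halves and derivatives -/

/-! The proof has two halves: a bound on list sizes and a recursive decoder whose running time is
polynomial in that bound, in `2 ^ n`, for fixed `d`.

List sizes (`exists_card_codeBall_le`). By induction on the degree, at most `2 ^ O(n ^ ℓ)` codewords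
lie within relative radius `(1 - η) * 2 ^ (ℓ - d)`. For `d ≤ ℓ` the whole code is that small. For
larger degree, the radius is at most `(1 - η) / 2`, so the error word `p + R` is biased towards `0`,
and a majority of `t` of its derivatives recovers it up to an error exponentially small in `t`
(`exists_majority`). Once this error is below half the minimum distance, `p` is determined by the
`t` directions and the derivatives of `p` in them. These have degree one less and lie within twice
the radius of the derivatives of `R`, so the induction hypothesis counts them; `t` does not depend
on `n`.

Decoding (`decode`). Splitting off the first coordinate, one half of a close codeword is within half
the permitted distance, so it appears in a recursive list of the same degree. The other half differs
from it by a word of smaller degree, found by a second recursive call. Both calls preserve the bound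
on distance times `2 ^ d` relative to `2 ^ n` (`RadiusBound`), so a single `M` bounds all lists in
the recursion. Each step costs two calls of the same degree and `O(M)` of smaller degree, which
gives a factor `O(1)` per coordinate and a factor `O(M ^ 2)` per degree (`callLe_dec`). -/

/-- The restriction of a word to the points whose first coordinate is `b`. -/
def half {n : ℕ} (b : ZMod 2) (f : Word (n + 1)) : Word n := fun x => f (Fin.cons b x)

/-- The word with the given two halves. -/
def join {n : ℕ} (f g : Word n) : Word (n + 1) :=
  fun x => if x 0 = 0 then f (Fin.tail x) else g (Fin.tail x)

/-- The discrete derivative in direction `a`. -/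
def wordDeriv {n : ℕ} (a : Fin n → ZMod 2) (f : Word n) : Word n := fun x => f (x + a) + f x

theorem zmod_two_cases (b : ZMod 2) : b = 0 ∨ b = 1 := by
  fin_cases b
  · exact Or.inl rfl
  · exact Or.inr rfl

theorem zmod_two_add_self (b : ZMod 2) : b + b = 0 := CharTwo.add_self_eq_zero b

theorem word_add_self {n : ℕ} (f : Word n) : f + f = 0 := by
  funext x; exact zmod_two_add_self _

theorem word_add_cancel {n : ℕ} (f g : Word n) : f + (f + g) = g := by
  rw [← add_assoc, word_add_self, zero_add]

@[simp] theorem half_zero_join {n : ℕ} (f g : Word n) : half 0 (join f g) = f := by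
  funext x; simp [half, join]

@[simp] theorem half_one_join {n : ℕ} (f g : Word n) : half 1 (join f g) = g := by
  funext x; simp [half, join]

theorem join_half {n : ℕ} (f : Word (n + 1)) : join (half 0 f) (half 1 f) = f := by
  funext x
  rcases zmod_two_cases (x 0) with h | h
  · simp only [join, half, h, if_true]
    rw [← h, Fin.cons_self_tail]
  · simp only [join, half, h, one_ne_zero, if_false]
    rw [← h, Fin.cons_self_tail]

theorem ext_half {n : ℕ} {f g : Word (n + 1)} (h0 : half 0 f = half 0 g)
    (h1 : half 1 f = half 1 g) : f = g := by
  rw [← join_half f, ← join_half g, h0, h1]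

theorem half_add {n : ℕ} (b : ZMod 2) (f g : Word (n + 1)) :
    half b (f + g) = half b f + half b g := rfl

theorem encodeWord_succ {n : ℕ} (f : Word (n + 1)) :
    encodeWord f = .cons (encodeWord (half 0 f)) (encodeWord (half 1 f)) := rfl

theorem encodeWord_join {n : ℕ} (f g : Word n) :
    encodeWord (join f g) = .cons (encodeWord f) (encodeWord g) := by
  rw [encodeWord_succ, half_zero_join, half_one_join]

theorem hammingDist_eq_sum {n : ℕ} (f g : Word n) :
    hammingDist f g = ∑ x, if f x ≠ g x then 1 else 0 := by
  rw [hammingDist, Finset.card_filter]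

theorem hammingDist_succ {n : ℕ} (f g : Word (n + 1)) :
    hammingDist f g
      = hammingDist (half 0 f) (half 0 g) + hammingDist (half 1 f) (half 1 g) := by
  simp only [hammingDist_eq_sum]
  rw [← (Fin.consEquiv fun _ : Fin (n + 1) => ZMod 2).sum_comp, Fintype.sum_prod_type]
  exact Fin.sum_univ_two _

theorem hammingDist_zero_dim (f g : Word 0) :
    hammingDist f g = if f Fin.elim0 = g Fin.elim0 then 0 else 1 := by
  rw [hammingDist_eq_sum, Fintype.sum_eq_single (Fin.elim0 : Fin 0 → ZMod 2)]
  · simp only [ne_eq, ite_not]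
  · intro x hx; exact absurd (Subsingleton.elim _ _) hx

theorem hammingDist_add_left {n : ℕ} (f g h : Word n) :
    hammingDist (f + g) (f + h) = hammingDist g h := by
  simp [hammingDist]

theorem hammingDist_shift {n : ℕ} (a : Fin n → ZMod 2) (f g : Word n) :
    hammingDist (fun x => f (x + a)) (fun x => g (x + a)) = hammingDist f g := by
  simp only [hammingDist_eq_sum]
  exact Fintype.sum_equiv (Equiv.addRight a) _ _ fun x => rfl

theorem hammingDist_add_add_le {n : ℕ} (f g f' g' : Word n) :
    hammingDist (f + g) (f' + g') ≤ hammingDist f f' + hammingDist g g' := by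
  refine (hammingDist_triangle _ (f' + g) _).trans ?_
  rw [hammingDist_add_left, add_comm f, add_comm f', hammingDist_add_left]

theorem hammingDist_wordDeriv_le {n : ℕ} (a : Fin n → ZMod 2) (f g : Word n) :
    hammingDist (wordDeriv a f) (wordDeriv a g) ≤ 2 * hammingDist f g := by
  refine (hammingDist_add_add_le (fun x => f (x + a)) f (fun x => g (x + a)) g).trans ?_
  rw [hammingDist_shift, two_mul]

/-! ## Recursive description of Reed–Muller codes -/

/-- Words of degree at most `d`, by recursion on the first coordinate (Plotkin construction). -/
def IsLow : (n d : ℕ) → Word n → Prop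
  | _, 0, f => ∃ c : ZMod 2, f = fun _ => c
  | 0, _ + 1, _ => True
  | n + 1, d + 1, f => IsLow n (d + 1) (half 0 f) ∧ IsLow n d (half 0 f + half 1 f)

theorem isLow_zero {n : ℕ} {f : Word n} : IsLow n 0 f ↔ ∃ c : ZMod 2, f = fun _ => c := by
  cases n <;> simp [IsLow]

theorem isLow_succ {n d : ℕ} {f : Word (n + 1)} :
    IsLow (n + 1) (d + 1) f ↔ IsLow n (d + 1) (half 0 f) ∧ IsLow n d (half 0 f + half 1 f) := by
  rw [IsLow]

theorem isLow_dim_zero (d : ℕ) (f : Word 0) : IsLow 0 d f := by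
  cases d with
  | zero => exact isLow_zero.2 ⟨f Fin.elim0, funext fun x => congrArg f (Subsingleton.elim _ _)⟩
  | succ d => simp [IsLow]

theorem IsLow.add {n d : ℕ} {f g : Word n} (hf : IsLow n d f) (hg : IsLow n d g) :
    IsLow n d (f + g) := by
  induction n generalizing d with
  | zero => exact isLow_dim_zero _ _
  | succ n ih =>
    cases d with
    | zero =>
      obtain ⟨c, rfl⟩ := isLow_zero.1 hf
      obtain ⟨e, rfl⟩ := isLow_zero.1 hg
      exact isLow_zero.2 ⟨c + e, rfl⟩
    | succ d =>
      rw [isLow_succ] at *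
      refine ⟨ih hf.1 hg.1, ?_⟩
      rw [half_add, half_add, add_add_add_comm]
      exact ih hf.2 hg.2

theorem IsLow.succ {n d : ℕ} {f : Word n} (hf : IsLow n d f) : IsLow n (d + 1) f := by
  induction n generalizing d with
  | zero => exact isLow_dim_zero _ _
  | succ n ih =>
    cases d with
    | zero =>
      obtain ⟨c, rfl⟩ := isLow_zero.1 hf
      refine isLow_succ.2 ⟨ih (isLow_zero.2 ⟨c, rfl⟩), isLow_zero.2 ⟨c + c, rfl⟩⟩
    | succ d =>
      rw [isLow_succ] at *
      exact ⟨ih hf.1, ih hf.2⟩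

theorem IsLow.half_one {n d : ℕ} {f : Word (n + 1)} (hf : IsLow (n + 1) (d + 1) f) :
    IsLow n (d + 1) (half 1 f) := by
  rw [isLow_succ] at hf
  rw [← word_add_cancel (half 0 f) (half 1 f)]
  exact hf.1.add hf.2.succ

theorem half_shift {n : ℕ} (a : Fin (n + 1) → ZMod 2) (f : Word (n + 1)) (b : ZMod 2) :
    half b (fun x => f (x + a)) = fun x => half (b + a 0) f (x + Fin.tail a) := by
  funext x
  refine congrArg f (funext fun i => ?_)
  refine Fin.cases ?_ (fun i => ?_) i
  · simp
  · simp [Fin.tail]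

theorem IsLow.shift {n d : ℕ} {f : Word n} (hf : IsLow n d f) (a : Fin n → ZMod 2) :
    IsLow n d (fun x => f (x + a)) := by
  induction n generalizing d with
  | zero => exact isLow_dim_zero _ _
  | succ n ih =>
    cases d with
    | zero =>
      obtain ⟨c, rfl⟩ := isLow_zero.1 hf
      exact isLow_zero.2 ⟨c, rfl⟩
    | succ d =>
      have h1 := hf.half_one
      rw [isLow_succ] at hf
      rw [isLow_succ, half_shift, half_shift]
      have hq := ih hf.2 (Fin.tail a)
      rcases zmod_two_cases (a 0) with h | h <;> rw [h]
      · refine ⟨ih (by simpa using hf.1) _, ?_⟩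
        rw [add_zero, add_zero]
        exact hq
      · refine ⟨ih (by simpa using h1) _, ?_⟩
        rw [zmod_two_add_self, zero_add, add_comm]
        exact hq

/-- With `q` the sum of the halves of `f`, the first half of the derivative is a derivative of `half
0 f`, plus a shift of `q` if `a 0 = 1`; the sum of its halves is the derivative of `q` along
`Fin.tail a`. -/
theorem isLow_wordDeriv {n d : ℕ} {f : Word n}
    (hf : IsLow n (d + 1) f) (a : Fin n → ZMod 2) :
    IsLow n d (wordDeriv a f) := by
  induction n generalizing d with
  | zero => exact isLow_dim_zero _ _
  | succ n ih =>
    rw [isLow_succ] at hf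
    have hd : ∀ b, half b (wordDeriv a f)
        = (fun x => half (b + a 0) f (x + Fin.tail a)) + half b f := by
      intro b
      rw [← half_shift]
      rfl
    have key : IsLow n d (half 0 (wordDeriv a f)) := by
      rw [hd, zero_add]
      rcases zmod_two_cases (a 0) with h | h <;> rw [h]
      · exact ih hf.1 _
      · have : (fun x => half 1 f (x + Fin.tail a)) + half 0 f
            = wordDeriv (Fin.tail a) (half 0 f)
              + fun x => (half 0 f + half 1 f) (x + Fin.tail a) := by
          funext x
          have := zmod_two_add_self (half 0 f (x + Fin.tail a))
          simp only [Pi.add_apply, wordDeriv]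
          linear_combination -this
        rw [this]
        exact (ih hf.1 _).add (hf.2.shift _)
    -- Degree `0` is separate because `IsLow` has no recursion there: `q` is constant, so the two
    -- halves of the derivative coincide.
    cases d with
    | zero =>
      obtain ⟨c, hc⟩ := isLow_zero.1 hf.2
      obtain ⟨e, he⟩ := isLow_zero.1 key
      refine isLow_zero.2 ⟨e, ext_half he ?_⟩
      have hs : half 1 (wordDeriv a f) = half 0 (wordDeriv a f) := by
        have h1 : half 1 f = half 0 f + fun _ => c := by rw [← hc, word_add_cancel]
        rw [hd, hd, zero_add]
        rcases zmod_two_cases (a 0) with h | h <;> rw [h]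
        · rw [add_zero, h1]
          funext x
          simp only [Pi.add_apply]
          linear_combination zmod_two_add_self c
        · rw [zmod_two_add_self, h1]
          funext x
          simp only [Pi.add_apply]
          ring
      rw [hs]
      exact he
    | succ d =>
      refine isLow_succ.2 ⟨key, ?_⟩
      have : half 0 (wordDeriv a f) + half 1 (wordDeriv a f)
          = wordDeriv (Fin.tail a) (half 0 f + half 1 f) := by
        rw [hd, hd, zero_add]
        rcases zmod_two_cases (a 0) with h | h <;> rw [h]
        · rw [add_zero]
          funext x
          simp only [Pi.add_apply, wordDeriv]
          ring
        · rw [zmod_two_add_self]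
          funext x
          simp only [Pi.add_apply, wordDeriv]
          ring
      rw [this]
      exact ih hf.2 _

/-- A nonzero word of degree at most `d` has relative weight at least `2⁻ᵈ`. -/
theorem IsLow.le_hammingDist_zero {n d : ℕ} {f : Word n} (hf : IsLow n d f) (h0 : f ≠ 0) :
    2 ^ n ≤ hammingDist f 0 * 2 ^ d := by
  induction n generalizing d with
  | zero =>
    have := hammingDist_pos.2 h0
    calc 2 ^ 0 ≤ 1 * 1 := le_rfl
      _ ≤ _ := Nat.mul_le_mul this Nat.one_le_two_pow
  | succ n ih =>
    cases d with
    | zero =>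
      obtain ⟨c, rfl⟩ := isLow_zero.1 hf
      have hc : c ≠ 0 := fun h => h0 (by rw [h]; rfl)
      have : hammingDist (fun _ => c : Word (n + 1)) 0 = 2 ^ (n + 1) := by
        simp [hammingDist, hc]
      rw [this, pow_zero, mul_one]
    | succ d =>
      rw [isLow_succ] at hf
      have hz : ∀ b, half b (0 : Word (n + 1)) = 0 := fun b => rfl
      rw [hammingDist_succ, hz, hz]
      by_cases hq : half 0 f + half 1 f = 0
      · have h1 : half 1 f = half 0 f := by
          rw [← word_add_cancel (half 0 f) (half 1 f), hq, add_zero]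
        have hne : half 0 f ≠ 0 := fun h => h0 (ext_half h (h1.trans h))
        have := ih hf.1 hne
        rw [h1, pow_succ]
        linarith
      · have h1 := ih hf.2 hq
        have h2 := hammingDist_add_add_le (half 0 f) (half 1 f) 0 0
        rw [add_zero] at h2
        rw [pow_succ, pow_succ, ← mul_assoc]
        exact Nat.mul_le_mul_right 2 (h1.trans (Nat.mul_le_mul_right _ h2))

theorem IsLow.eq_of_hammingDist_lt {n d : ℕ} {f g : Word n} (hf : IsLow n d f) (hg : IsLow n d g)
    (h : hammingDist f g * 2 ^ d < 2 ^ n) : f = g := by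
  by_contra hne
  have h1 : f + g ≠ 0 := fun h0 => hne (by
    rw [← word_add_cancel f g, h0, add_zero])
  have := (hf.add hg).le_hammingDist_zero h1
  have e : hammingDist (f + g) 0 = hammingDist f g := by
    rw [← word_add_self f, hammingDist_add_left, hammingDist_comm]
  rw [e] at this
  omega

open Classical in
theorem card_isLow_le (n d : ℕ) :
    (Finset.univ.filter (IsLow n d)).card ≤ 2 ^ (n + 1) ^ d := by
  induction n generalizing d with
  | zero =>
    refine (Finset.card_le_univ _).trans ?_
    simp
  | succ n ih =>
    cases d with
    | zero =>
      have : Finset.univ.filter (IsLow (n + 1) 0)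
          ⊆ (Finset.univ : Finset (ZMod 2)).image (fun c _ => c) := by
        intro f hf
        obtain ⟨c, rfl⟩ := isLow_zero.1 (Finset.mem_filter.1 hf).2
        exact Finset.mem_image_of_mem _ (Finset.mem_univ c)
      refine (Finset.card_le_card this).trans (Finset.card_image_le.trans ?_)
      simp
    | succ d =>
      have : (Finset.univ.filter (IsLow (n + 1) (d + 1))).card
          ≤ (Finset.univ.filter (IsLow n (d + 1)) ×ˢ Finset.univ.filter (IsLow n d)).card := by
        refine Finset.card_le_card_of_injOn (fun f => (half 0 f, half 0 f + half 1 f)) ?_ ?_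
        · intro f hf
          have := isLow_succ.1 (Finset.mem_filter.1 hf).2
          simp [this.1, this.2]
        · intro f _ g _ h
          obtain ⟨h0, h1⟩ := Prod.mk.inj h
          refine ext_half h0 ?_
          rw [h0] at h1
          exact add_left_cancel h1
      refine this.trans ?_
      rw [Finset.card_product]
      refine (Nat.mul_le_mul (ih _) (ih _)).trans ?_
      rw [← pow_add]
      refine Nat.pow_le_pow_right two_pos ?_
      calc (n + 1) ^ (d + 1) + (n + 1) ^ d = (n + 1) ^ d * (n + 1 + 1) := by ring
        _ ≤ (n + 1 + 1) ^ d * (n + 1 + 1) :=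
          Nat.mul_le_mul_right _ (Nat.pow_le_pow_left (Nat.le_succ _) _)

-- Expand in powers of the first variable with coefficients `r.coeff i`. Putting it to `0` leaves
-- the constant coefficient; the sum of the two halves is the sum of the others, each of degree at
-- most `d`. Multilinearity is not needed.
open MvPolynomial in
theorem isLow_of_mem_RM {n d : ℕ} {f : Word n} (hf : f ∈ RM n d) : IsLow n d f := by
  induction n generalizing d with
  | zero => exact isLow_dim_zero _ _
  | succ n ih =>
    obtain ⟨q, hq, hfq⟩ := hf
    cases d with
    | zero =>
      refine isLow_zero.2 ⟨q.coeff 0, funext fun x => ?_⟩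
      rw [hfq, totalDegree_eq_zero_iff_eq_C.1 (Nat.le_zero.1 hq)]
      simp
    | succ d =>
      set r := finSuccEquiv (ZMod 2) n q with hr
      have hev : ∀ b x, half b f x = ∑ i ∈ Finset.range (r.natDegree + 1),
          eval x (r.coeff i) * b ^ i := by
        intro b x
        rw [half, hfq, eval_eq_eval_mv_eval', ← hr, Polynomial.eval_eq_sum_range'
          (n := r.natDegree + 1)]
        · simp [Polynomial.coeff_map]
        · exact Nat.lt_succ_of_le Polynomial.natDegree_map_le
      have hdeg : ∀ i, (r.coeff i).totalDegree + i ≤ d + 1 ∨ r.coeff i = 0 := by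
        intro i
        by_cases h : r.coeff i = 0
        · exact Or.inr h
        · exact Or.inl ((totalDegree_coeff_finSuccEquiv_add_le q i h).trans hq)
      have h0 : ∀ x, half 0 f x = eval x (r.coeff 0) := by
        intro x
        rw [hev, Finset.sum_range_succ']
        simp
      refine isLow_succ.2 ⟨ih ⟨r.coeff 0, ?_, h0⟩,
        ih ⟨∑ i ∈ Finset.range r.natDegree, r.coeff (i + 1), ?_, ?_⟩⟩
      · rcases hdeg 0 with h | h
        · simpa using h
        · simp [h]
      · refine totalDegree_finsetSum_le fun i _ => ?_
        rcases hdeg (i + 1) with h | h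
        · omega
        · simp [h]
      · intro x
        rw [Pi.add_apply, h0, hev, Finset.sum_range_succ', map_sum]
        simp only [one_pow, mul_one]
        linear_combination zmod_two_add_self (eval x (r.coeff 0))

-- The Plotkin form read backwards: `f` is `half 0 f` plus the first variable times the sum of the
-- halves.
open MvPolynomial in
theorem mem_RM_of_isLow {n d : ℕ} {f : Word n} (hf : IsLow n d f) : f ∈ RM n d := by
  induction n generalizing d with
  | zero =>
    exact ⟨C (f Fin.elim0), by simp, fun x => by
      rw [eval_C]; exact congrArg f (Subsingleton.elim _ _)⟩
  | succ n ih =>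
    cases d with
    | zero =>
      obtain ⟨c, rfl⟩ := isLow_zero.1 hf
      exact ⟨C c, by simp, fun x => by simp⟩
    | succ d =>
      obtain ⟨h0, h1⟩ := isLow_succ.1 hf
      obtain ⟨p, hp, hfp⟩ := ih h0
      obtain ⟨q, hq, hfq⟩ := ih h1
      have hq' : half 1 f = fun x => eval x p + eval x q := by
        funext x
        rw [← hfp, ← hfq, ← Pi.add_apply, word_add_cancel]
      refine ⟨rename Fin.succ p + X 0 * rename Fin.succ q, ?_, fun x => ?_⟩
      · refine (totalDegree_add _ _).trans (max_le ((totalDegree_rename_le _ _).trans hp) ?_)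
        refine (totalDegree_mul _ _).trans ?_
        rw [totalDegree_X]
        have := totalDegree_rename_le (Fin.succ : Fin n → Fin (n + 1)) q
        omega
      · have hx : ∀ b, x 0 = b → f x = half b f (Fin.tail x) := by
          rintro b rfl
          rw [half, Fin.cons_self_tail]
        simp only [map_add, map_mul, eval_rename, eval_X]
        rcases zmod_two_cases (x 0) with h | h
        · rw [hx _ h, hfp, h, zero_mul, add_zero]
          rfl
        · rw [hx _ h, hq', h, one_mul]
          rfl

theorem mem_RM_iff {n d : ℕ} {f : Word n} : f ∈ RM n d ↔ IsLow n d f :=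
  ⟨isLow_of_mem_RM, mem_RM_of_isLow⟩

/-! ## List size -/

open Classical in
/-- The words of degree at most `d` that differ from `R` at fewer than `B` points. -/
noncomputable def codeBall (n d B : ℕ) (R : Word n) : Finset (Word n) :=
  Finset.univ.filter fun p => IsLow n d p ∧ hammingDist p R < B

theorem mem_codeBall {n d B : ℕ} {R p : Word n} :
    p ∈ codeBall n d B R ↔ IsLow n d p ∧ hammingDist p R < B := by
  simp [codeBall]

/-- All distances below `B` are at most `c · 2ⁿ⁻ᵈ`. -/
def RadiusBound (c : ℝ) (n d B : ℕ) : Prop := ∀ h : ℕ, h < B → (h : ℝ) * 2 ^ d ≤ c * 2 ^ n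

/-- The exponential-moment bound of a Chernoff argument: the product dominates the indicator of a
majority and factorises over independent samples. -/
theorem one_le_prod_of_majority {t : ℕ} {γ : ℝ} (hγ : 1 ≤ γ) (s : Fin t → Prop) [DecidablePred s]
    (h : (Finset.univ.filter fun i => ¬ s i).card ≤ (Finset.univ.filter s).card) :
    1 ≤ ∏ i, (if s i then γ else γ⁻¹) := by
  rw [Finset.prod_ite, Finset.prod_const, Finset.prod_const, inv_pow, ← div_eq_mul_inv,
    one_le_div (pow_pos (zero_lt_one.trans_le hγ) _)]
  exact pow_le_pow_right₀ hγ h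

/-- The pointwise majority of the words `D i`, with ties broken towards `1`. -/
def majority {n t : ℕ} (D : Fin t → Word n) : Word n := fun x =>
  if (Finset.univ.filter fun i => D i x = 0).card ≤ (Finset.univ.filter fun i => D i x ≠ 0).card
  then 1 else 0

/-- A derivative `f (x + a) + f x` is a wrong guess for `f x` exactly when `f (x + a) = 1`. The
inequality is not strict, so the rule for ties does not matter. -/
theorem majority_wrong {n t : ℕ} (a : Fin t → Fin n → ZMod 2) (f : Word n) (x : Fin n → ZMod 2)
    (h : majority (fun i => wordDeriv (a i) f) x ≠ f x) :
    (Finset.univ.filter fun i => ¬ f (x + a i) ≠ 0).card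
      ≤ (Finset.univ.filter fun i => f (x + a i) ≠ 0).card := by
  have h01 : ∀ b : ZMod 2, b ≠ 0 ↔ b = 1 := by decide
  rcases zmod_two_cases (f x) with hx | hx
  · rw [hx] at h
    have e : ∀ i, wordDeriv (a i) f x = f (x + a i) := fun i => by
      rw [wordDeriv, hx, add_zero]
    simp only [majority, e] at h
    simp only [not_not]
    by_contra hc
    exact h (if_neg hc)
  · rw [hx] at h
    have e : ∀ i, wordDeriv (a i) f x = 0 ↔ f (x + a i) ≠ 0 := fun i => by
      rw [wordDeriv, hx, h01]
      generalize f (x + a i) = b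
      revert b; decide
    simp only [majority, ne_eq, e, not_not] at h
    simp only [ne_eq, not_not]
    by_contra hc
    exact h (if_pos (le_of_not_ge hc))

/-- A word of relative weight at most `(1-η)/2` is the majority of `t` suitable derivatives, up to
a relative error that is exponentially small in `t`. -/
theorem exists_majority {n : ℕ} (t : ℕ) {η : ℝ} (h0 : 0 ≤ η) (f : Word n)
    (hf : (hammingDist f 0 : ℝ) ≤ (1 - η) / 2 * 2 ^ n) :
    ∃ a : Fin t → Fin n → ZMod 2,
      (hammingDist (majority fun i => wordDeriv (a i) f) f : ℝ) ≤ (1 - η ^ 2 / 2) ^ t * 2 ^ n := by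
  -- The base `1 + η` makes the mean of `u` equal to `1 - η ^ 2 / 2` when the relative weight of `f`
  -- is exactly `(1 - η) / 2`.
  set u : (Fin n → ZMod 2) → ℝ := fun b => if f b ≠ 0 then 1 + η else (1 + η)⁻¹ with hu
  have hpos : (0 : ℝ) < 1 + η := by linarith
  have hcard : (Fintype.card (Fin n → ZMod 2) : ℝ) = 2 ^ n := by simp
  have hsum : ∑ b, u b ≤ (1 - η ^ 2 / 2) * 2 ^ n := by
    have hw : ((Finset.univ.filter fun b => f b ≠ 0).card : ℝ) = hammingDist f 0 := rfl
    have hw' : ((Finset.univ.filter fun b => ¬ f b ≠ 0).card : ℝ) = 2 ^ n - hammingDist f 0 := by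
      rw [← hw, ← hcard, ← Finset.card_univ,
        ← Finset.card_filter_add_card_filter_not (s := Finset.univ) (fun b => f b ≠ 0)]
      push_cast
      ring
    rw [hu, Finset.sum_ite, Finset.sum_const, Finset.sum_const, nsmul_eq_mul, nsmul_eq_mul, hw, hw']
    have hinv : (1 + η)⁻¹ ≤ 1 + η := (inv_le_one_of_one_le₀ (by linarith)).trans (by linarith)
    have hmul : (1 + η) * (1 + η)⁻¹ = 1 := mul_inv_cancel₀ hpos.ne'
    calc (hammingDist f 0 : ℝ) * (1 + η) + (2 ^ n - hammingDist f 0) * (1 + η)⁻¹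
        = hammingDist f 0 * ((1 + η) - (1 + η)⁻¹) + 2 ^ n * (1 + η)⁻¹ := by ring
      _ ≤ (1 - η) / 2 * 2 ^ n * ((1 + η) - (1 + η)⁻¹) + 2 ^ n * (1 + η)⁻¹ := by
        gcongr
      _ = (1 - η ^ 2 / 2) * 2 ^ n := by linear_combination (2 ^ n / 2 : ℝ) * hmul
  have hu0 : ∀ b, 0 ≤ u b := fun b => by
    simp only [hu]; split_ifs <;> positivity
  have hshift : ∀ x, ∑ b, u (x + b) = ∑ b, u b := fun x =>
    Fintype.sum_equiv (Equiv.addLeft x) _ _ fun b => rfl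
  have hle : ∀ a : Fin t → Fin n → ZMod 2,
      (hammingDist (majority fun i => wordDeriv (a i) f) f : ℝ) ≤ ∑ x, ∏ i, u (x + a i) := by
    intro a
    rw [hammingDist_eq_sum, Nat.cast_sum]
    refine Finset.sum_le_sum fun x _ => ?_
    split_ifs with h
    · rw [Nat.cast_one]
      exact one_le_prod_of_majority (by linarith) (fun i => f (x + a i) ≠ 0) (majority_wrong a f x h)
    · rw [Nat.cast_zero]
      exact Finset.prod_nonneg fun i _ => hu0 _
  -- First-moment method: if every tuple of directions failed, summing over all tuples would
  -- contradict the factorised value `(∑ b, u b) ^ t` at each point.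
  by_contra! hcon
  have hlt : ∑ _a : Fin t → Fin n → ZMod 2, (1 - η ^ 2 / 2) ^ t * 2 ^ n
      < ∑ a : Fin t → Fin n → ZMod 2, ∑ x, ∏ i, u (x + a i) :=
    Finset.sum_lt_sum_of_nonempty Finset.univ_nonempty fun a _ => (hcon a).trans_le (hle a)
  refine absurd hlt (not_lt.2 ?_)
  rw [Finset.sum_comm]
  have : ∀ x, ∑ a : Fin t → Fin n → ZMod 2, ∏ i, u (x + a i) = (∑ b, u b) ^ t := fun x => by
    rw [← hshift x, Fintype.sum_pow]
  simp only [this, Finset.sum_const, Finset.card_univ, nsmul_eq_mul, Fintype.card_fun,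
    Fintype.card_fin, ZMod.card]
  push_cast
  calc (2 : ℝ) ^ n * (∑ b, u b) ^ t ≤ 2 ^ n * ((1 - η ^ 2 / 2) * 2 ^ n) ^ t := by
        gcongr
    _ = _ := by rw [mul_pow, ← pow_mul]; ring

theorem wordDeriv_add {n : ℕ} (a : Fin n → ZMod 2) (f g : Word n) :
    wordDeriv a (f + g) = wordDeriv a f + wordDeriv a g := by
  funext x; simp only [wordDeriv, Pi.add_apply]; ring

theorem hammingDist_add_zero {n : ℕ} (f g : Word n) : hammingDist (f + g) 0 = hammingDist f g := by
  rw [← word_add_self f, hammingDist_add_left, hammingDist_comm]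

/-- List sizes for degree `d + 1` in terms of list sizes for degree `d`. -/
theorem card_codeBall_succ_le {n d B t N : ℕ} {η : ℝ} (h0 : 0 ≤ η)
    (ht : (1 - η ^ 2 / 2) ^ t * 2 ^ (d + 2) < 1)
    (hB : ∀ h : ℕ, h < B → (h : ℝ) ≤ (1 - η) / 2 * 2 ^ n)
    (hN : ∀ R, (codeBall n d (2 * B - 1) R).card ≤ N) (R : Word n) :
    (codeBall n (d + 1) B R).card ≤ 2 ^ (n * t) * N ^ t := by
  classical
  set good : (Fin t → Fin n → ZMod 2) → Finset (Word n) := fun a =>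
    (codeBall n (d + 1) B R).filter fun p =>
      (hammingDist (majority fun i => wordDeriv (a i) (p + R)) (p + R) : ℝ)
        ≤ (1 - η ^ 2 / 2) ^ t * 2 ^ n with hgood
  have hcover : codeBall n (d + 1) B R ⊆ Finset.univ.biUnion good := by
    intro p hp
    have hp' := mem_codeBall.1 hp
    obtain ⟨a, ha⟩ := exists_majority t h0 (p + R) (by
      rw [hammingDist_add_zero]
      exact hB _ hp'.2)
    exact Finset.mem_biUnion.2 ⟨a, Finset.mem_univ _, Finset.mem_filter.2 ⟨hp, ha⟩⟩
  have hone : ∀ a, (good a).card ≤ N ^ t := by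
    intro a
    have hle : (good a).card
        ≤ (Fintype.piFinset fun i => codeBall n d (2 * B - 1) (wordDeriv (a i) R)).card := by
      refine Finset.card_le_card_of_injOn (fun p i => wordDeriv (a i) p) ?_ ?_
      · intro p hp
        obtain ⟨hlow, hdist⟩ := mem_codeBall.1 (Finset.mem_filter.1 hp).1
        refine Fintype.mem_piFinset.2 fun i => mem_codeBall.2 ⟨isLow_wordDeriv hlow _, ?_⟩
        have := hammingDist_wordDeriv_le (a i) p R
        exact this.trans_lt (by omega)
      · intro p hp p' hp' heq
        obtain ⟨hpb, hpm⟩ := Finset.mem_filter.1 hp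
        obtain ⟨hpb', hpm'⟩ := Finset.mem_filter.1 hp'
        refine (mem_codeBall.1 hpb).1.eq_of_hammingDist_lt (mem_codeBall.1 hpb').1 ?_
        -- Equal derivatives give one majority word close to both `p + R` and `p' + R`; the triangle
        -- inequality then puts `p` and `p'` below the minimum distance.
        have hD : (fun i => wordDeriv (a i) (p + R)) = fun i => wordDeriv (a i) (p' + R) := by
          funext i
          rw [wordDeriv_add, wordDeriv_add]
          exact congrArg (· + _) (congrFun heq i)
        rw [hD] at hpm
        have htri := hammingDist_triangle_right (p + R) (p' + R)
          (majority fun i => wordDeriv (a i) (p' + R))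
        rw [add_comm p, add_comm p', hammingDist_add_left, add_comm R, add_comm R] at htri
        rw [hammingDist_comm] at hpm hpm'
        have hlt : ((hammingDist p p' * 2 ^ (d + 1) : ℕ) : ℝ) < (2 ^ n : ℕ) := by
          have htri' : (hammingDist p p' : ℝ) ≤ (1 - η ^ 2 / 2) ^ t * 2 ^ n * 2 := by
            have : (hammingDist p p' : ℝ) ≤ _ := Nat.cast_le.2 htri
            push_cast at this
            linarith
          push_cast
          calc (hammingDist p p' : ℝ) * 2 ^ (d + 1)
              ≤ (1 - η ^ 2 / 2) ^ t * 2 ^ n * 2 * 2 ^ (d + 1) := by gcongr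
            _ = ((1 - η ^ 2 / 2) ^ t * 2 ^ (d + 2)) * 2 ^ n := by ring
            _ < 1 * 2 ^ n := by gcongr
            _ = 2 ^ n := one_mul _
        exact_mod_cast hlt
    refine hle.trans ?_
    rw [Fintype.card_piFinset]
    refine (Finset.prod_le_pow_card _ _ N fun i _ => hN _).trans ?_
    simp
  refine (Finset.card_le_card hcover).trans
    ((Finset.card_biUnion_le_card_mul _ _ _ fun a _ => hone a).trans ?_)
  simp [pow_mul]

/-- The list size bound: `2^{O(n^ℓ)}` codewords below relative radius `(1-η) 2^{ℓ-d}`. -/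
theorem exists_card_codeBall_le {ℓ : ℕ} (hℓ : 1 ≤ ℓ) {η : ℝ} (h0 : 0 < η) (h1 : η ≤ 1) (d : ℕ) :
    ∃ C : ℕ, ∀ n B, RadiusBound ((1 - η) * 2 ^ ℓ) n d B →
      ∀ R, (codeBall n d B R).card ≤ 2 ^ (C * (n + 1) ^ ℓ) := by
  induction d with
  | zero =>
    refine ⟨1, fun n B _ R => ?_⟩
    classical
    refine (Finset.card_le_card (t := Finset.univ.filter (IsLow n 0)) fun p hp => ?_).trans
      ((card_isLow_le n 0).trans (Nat.pow_le_pow_right two_pos ?_))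
    · simpa using (mem_codeBall.1 hp).1
    · rw [one_mul]; exact Nat.pow_le_pow_right (Nat.succ_pos n) (Nat.zero_le ℓ)
  | succ d ih =>
    -- Up to degree `ℓ` the size of the whole code suffices.
    rcases Nat.lt_or_ge d ℓ with hd | hd
    · refine ⟨1, fun n B _ R => ?_⟩
      classical
      refine (Finset.card_le_card (t := Finset.univ.filter (IsLow n (d + 1))) fun p hp => ?_).trans
        ((card_isLow_le n (d + 1)).trans (Nat.pow_le_pow_right two_pos ?_))
      · simpa using (mem_codeBall.1 hp).1
      · rw [one_mul]; exact Nat.pow_le_pow_right (Nat.succ_pos n) hd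
    · obtain ⟨C, hC⟩ := ih
      -- The error `2 ^ (-(d + 2))` is half the relative minimum distance in degree `d + 1`.
      obtain ⟨t, ht⟩ := exists_pow_lt_of_lt_one (show (0 : ℝ) < 1 / 2 ^ (d + 2) by positivity)
        (show 1 - η ^ 2 / 2 < 1 by nlinarith)
      refine ⟨t + C * t, fun n B hB R => ?_⟩
      have := card_codeBall_succ_le (n := n) (d := d) (B := B) (t := t)
        (N := 2 ^ (C * (n + 1) ^ ℓ)) h0.le ((lt_div_iff₀ (by positivity)).1 ht) ?_
        (hC n (2 * B - 1) ?_) R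
      · refine this.trans ?_
        rw [← pow_mul, ← pow_add]
        refine Nat.pow_le_pow_right two_pos ?_
        have hn : n ≤ (n + 1) ^ ℓ :=
          (Nat.le_succ n).trans (Nat.le_self_pow (by omega) _)
        nlinarith
      · intro h hh
        have h2 := hB h hh
        have h3 : (2 : ℝ) ^ ℓ ≤ 2 ^ d := pow_le_pow_right₀ one_le_two hd
        have h4 : (h : ℝ) * 2 ^ (d + 1) ≤ (1 - η) / 2 * 2 ^ n * 2 ^ (d + 1) := by
          refine h2.trans ?_
          calc (1 - η) * 2 ^ ℓ * 2 ^ n ≤ (1 - η) * 2 ^ d * 2 ^ n := by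
                have : 0 ≤ 1 - η := by linarith
                gcongr
            _ = _ := by ring
        exact le_of_mul_le_mul_right h4 (by positivity)
      -- Doubling the distance is offset by lowering the degree by one, so the constant in
      -- `RadiusBound` is unchanged.
      · intro h hh
        have h2 := hB (B - 1) (by omega)
        have h3 : h ≤ 2 * (B - 1) := by omega
        have h4 : (h : ℝ) ≤ 2 * ((B - 1 : ℕ) : ℝ) := by exact_mod_cast h3
        calc (h : ℝ) * 2 ^ d ≤ 2 * ((B - 1 : ℕ) : ℝ) * 2 ^ d := by gcongr
          _ = ((B - 1 : ℕ) : ℝ) * 2 ^ (d + 1) := by ring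
          _ ≤ _ := h2

/-! ## The algorithm, as a function on words -/

/-- Put the halves `p` and `f` together; `p` comes first if `G = 0` and second otherwise. -/
def pairUp {n : ℕ} (G : ℕ) (p f : Word n) : Word (n + 1) := if G = 0 then join p f else join f p

/-- All words with halves `p` and `p + q`, `q ∈ Q`, at distance less than `B` from the word with
halves `S` and `T`, whose half `p + q` has distance at least `G` from `T`. -/
def extensions {n : ℕ} (S T : Word n) (B G : ℕ) (p : Word n) (Q : List (Word n)) :
    List (Word (n + 1)) :=
  (Q.filter fun q => G ≤ hammingDist (p + q) T ∧ hammingDist p S + hammingDist (p + q) T < B).map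
    fun q => pairUp G p (p + q)

/-- The constant words at distance less than `B` from `R`. -/
def constants {n : ℕ} (B : ℕ) (R : Word n) : List (Word n) :=
  ([fun _ => 0, fun _ => 1] : List (Word n)).filter fun p => hammingDist p R < B

/-- The words of degree at most `d` at distance less than `B` from `R`: one of the two halves is
within half the distance; the other half differs from it by a word of smaller degree. -/
def decode : (n d B : ℕ) → Word n → List (Word n)
  | 0, _, B, R => constants B R
  | _ + 1, 0, B, R => constants B R
  | n + 1, d + 1, B, R =>
    (decode n (d + 1) ((B + 1) / 2) (half 0 R)).flatMap (fun p =>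
        extensions (half 0 R) (half 1 R) B 0 p (decode n d B (half 1 R + p))) ++
      (decode n (d + 1) ((B + 1) / 2) (half 1 R)).flatMap fun p =>
        extensions (half 1 R) (half 0 R) B ((B + 1) / 2) p (decode n d B (half 0 R + p))

theorem mem_constants {n B : ℕ} {R p : Word n} :
    p ∈ constants B R ↔ IsLow n 0 p ∧ hammingDist p R < B := by
  simp only [constants, List.mem_filter, List.mem_cons, List.not_mem_nil, or_false,
    decide_eq_true_eq, isLow_zero]
  refine and_congr_left fun _ => ⟨?_, ?_⟩
  · rintro (h | h)
    · exact ⟨0, h⟩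
    · exact ⟨1, h⟩
  · rintro ⟨c, rfl⟩
    rcases zmod_two_cases c with rfl | rfl
    · exact Or.inl rfl
    · exact Or.inr rfl

theorem nodup_constants {n : ℕ} (B : ℕ) (R : Word n) : (constants B R).Nodup := by
  refine List.Nodup.filter _ ?_
  simp only [List.nodup_cons, List.mem_singleton, List.not_mem_nil, not_false_eq_true,
    List.nodup_nil, and_true]
  exact fun h => zero_ne_one (congrFun h 0)

theorem mem_extensions {n : ℕ} {S T : Word n} {B G : ℕ} {p : Word n} {Q : List (Word n)}
    {w : Word (n + 1)} :
    w ∈ extensions S T B G p Q ↔ ∃ f, p + f ∈ Q ∧ G ≤ hammingDist f T ∧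
      hammingDist p S + hammingDist f T < B ∧ w = pairUp G p f := by
  simp only [extensions, List.mem_map, List.mem_filter, decide_eq_true_eq]
  constructor
  · rintro ⟨q, ⟨hq, h1, h2⟩, rfl⟩
    exact ⟨p + q, by rwa [word_add_cancel], h1, h2, rfl⟩
  · rintro ⟨f, hf, h1, h2, rfl⟩
    exact ⟨p + f, by rw [word_add_cancel]; exact ⟨⟨hf, h1, h2⟩, rfl⟩⟩

theorem pairUp_injective {n : ℕ} {G : ℕ} {p f p' f' : Word n}
    (h : pairUp G p f = pairUp G p' f') : p = p' ∧ f = f' := by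
  have h0 := congrArg (half 0) h
  have h1 := congrArg (half 1) h
  unfold pairUp at h0 h1
  split_ifs at h0 h1 <;> simp only [half_zero_join, half_one_join] at h0 h1
  · exact ⟨h0, h1⟩
  · exact ⟨h1, h0⟩

theorem mem_decode {n d B : ℕ} {R w : Word n} :
    w ∈ decode n d B R ↔ IsLow n d w ∧ hammingDist w R < B := by
  induction n generalizing d B with
  | zero =>
    rw [decode, mem_constants]
    simp only [isLow_dim_zero]
  | succ n ih =>
    cases d with
    | zero => rw [decode, mem_constants]
    | succ d =>
      have hfar : ∀ p f T : Word n, hammingDist (p + f) (T + p) = hammingDist f T := by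
        intro p f T
        rw [add_comm T, hammingDist_add_left]
      rw [decode, List.mem_append, List.mem_flatMap, List.mem_flatMap]
      simp only [mem_extensions, ih, hfar, isLow_succ, hammingDist_succ w R]
      constructor
      · rintro (⟨p, ⟨hp, _⟩, f, ⟨hf, _⟩, _, h, rfl⟩ | ⟨p, ⟨hp, hp'⟩, f, ⟨hf, _⟩, _, h, rfl⟩)
        · simp only [pairUp, if_true, half_zero_join, half_one_join]
          exact ⟨⟨hp, hf⟩, h⟩
        -- `G` doubles as the order flag. In the second loop it is nonzero, as the distance of `p`
        -- lies strictly below it.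
        · rw [pairUp, if_neg (by omega), half_zero_join, half_one_join, add_comm f p,
            add_comm (hammingDist f _)]
          refine ⟨⟨?_, hf⟩, h⟩
          rw [← word_add_cancel p f]
          exact hp.add hf.succ
      · rintro ⟨⟨h0, h1⟩, h⟩
        -- The two half distances add up to less than `B`, so at least one is below `(B + 1) / 2`.
        by_cases hn : hammingDist (half 0 w) (half 0 R) < (B + 1) / 2
        · refine Or.inl ⟨half 0 w, ⟨h0, hn⟩, half 1 w, ⟨h1, by omega⟩, Nat.zero_le _, h, ?_⟩
          rw [pairUp, if_pos rfl, join_half]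
        · refine Or.inr ⟨half 1 w, ⟨(isLow_succ.2 ⟨h0, h1⟩).half_one, by omega⟩, half 0 w,
            ⟨add_comm (half 0 w) (half 1 w) ▸ h1, by omega⟩, by omega, by omega, ?_⟩
          rw [pairUp, if_neg (by omega), join_half]

theorem nodup_extensions {n : ℕ} {S T : Word n} {B G : ℕ} {p : Word n} {Q : List (Word n)}
    (h : Q.Nodup) : (extensions S T B G p Q).Nodup :=
  (h.filter _).map fun _ _ e => add_left_cancel (pairUp_injective e).2

theorem nodup_flatMap_extensions {n : ℕ} {S T : Word n} {B G : ℕ} {L : List (Word n)}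
    {D : Word n → List (Word n)} (hL : L.Nodup) (hD : ∀ p, (D p).Nodup) :
    (L.flatMap fun p => extensions S T B G p (D p)).Nodup := by
  refine List.nodup_flatMap.2 ⟨fun p _ => nodup_extensions (hD p), hL.imp fun {p p'} hne => ?_⟩
  intro w hw hw'
  obtain ⟨f, _, _, _, rfl⟩ := mem_extensions.1 hw
  obtain ⟨f', _, _, _, e⟩ := mem_extensions.1 hw'
  exact hne (pairUp_injective e).1

/-- The loops are disjoint: the first yields words whose first half is at distance below `(B + 1) /
2`, and the threshold `G` of the second excludes these. Without repetitions, list lengths are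
bounded by ball sizes. -/
theorem nodup_decode (n d B : ℕ) (R : Word n) : (decode n d B R).Nodup := by
  induction n generalizing d B with
  | zero => rw [decode]; exact nodup_constants _ _
  | succ n ih =>
    cases d with
    | zero => rw [decode]; exact nodup_constants _ _
    | succ d =>
      rw [decode]
      refine List.Nodup.append (nodup_flatMap_extensions (ih _ _ _) fun p => ih _ _ _)
        (nodup_flatMap_extensions (ih _ _ _) fun p => ih _ _ _) ?_
      intro w hw hw'
      obtain ⟨p, hp, hw⟩ := List.mem_flatMap.1 hw
      obtain ⟨p', _, hw'⟩ := List.mem_flatMap.1 hw'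
      obtain ⟨f, _, _, _, rfl⟩ := mem_extensions.1 hw
      obtain ⟨f', _, hG, _, e⟩ := mem_extensions.1 hw'
      have hp := (mem_decode.1 hp).2
      rw [pairUp, pairUp, if_pos rfl, if_neg (by omega)] at e
      have e0 := congrArg (half 0) e
      rw [half_zero_join, half_zero_join] at e0
      rw [e0] at hp
      omega

theorem length_decode_le (n d B : ℕ) (R : Word n) :
    (decode n d B R).length ≤ (codeBall n d B R).card := by
  classical
  rw [← List.toFinset_card_of_nodup (nodup_decode n d B R)]
  refine Finset.card_le_card fun p hp => ?_
  rw [List.mem_toFinset, mem_decode] at hp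
  exact mem_codeBall.2 hp

/-! ## The program -/

namespace Prog

open ReedMuller.Expr (var nil cons letIn caseOf call)

/-- Input `(n, d, A, R)`: call the decoder with `B = A + 1`. -/
def main : Expr :=
  caseOf (var 0) nil <| caseOf (var 1) nil <| caseOf (var 1) nil <|
  call 10 (cons (var 4) (cons (var 2) (cons (cons nil (var 0)) (var 1))))

/-- Input `(n, u, v)`: the sum of the words `u` and `v`. -/
def add : Expr :=
  caseOf (var 0) nil <| caseOf (var 1) nil <|
  caseOf (var 2) (caseOf (var 0) (var 1) (caseOf (var 3) (var 2) nil)) <|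
  caseOf (var 2) nil <| caseOf (var 5) nil <|
  cons (call 1 (cons (var 5) (cons (var 2) (var 0))))
    (call 1 (cons (var 5) (cons (var 3) (var 1))))

/-- Input `(n, u, v, B)`: `B` minus the Hamming distance of `u` and `v`. -/
def sub : Expr :=
  caseOf (var 0) nil <| caseOf (var 1) nil <| caseOf (var 1) nil <|
  caseOf (var 4)
    (caseOf (var 2)
      (caseOf (var 0) (var 1) (caseOf (var 3) nil (var 1)))
      (caseOf (var 2) (caseOf (var 3) nil (var 1)) (var 5))) <|
  caseOf (var 4) nil <| caseOf (var 4) nil <|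
  call 2 (cons (var 5) (cons (var 3) (cons (var 1)
    (call 2 (cons (var 5) (cons (var 2) (cons (var 0) (var 7))))))))

/-- Input `B`: half of `B + 1`, rounded down. -/
def up : Expr :=
  caseOf (var 0) nil <| caseOf (var 1) (cons nil nil) <| cons nil (call 3 (var 1))

/-- Input `(n, b)`: the constant word with value `b`. -/
def const : Expr :=
  caseOf (var 0) nil <| caseOf (var 0) (var 1) <|
  letIn (call 4 (cons (var 1) (var 3))) (cons (var 0) (var 0))

/-- Input `(g, s, w, l)`: the list `w :: l` if `g = 0` and `s ≠ 0`, otherwise `l`. -/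
def select : Expr :=
  caseOf (var 0) nil <| caseOf (var 1) nil <| caseOf (var 1) nil <|
  caseOf (var 4) (caseOf (var 2) (var 1) (cons (var 2) (var 3))) (var 3)

/-- Input `(n, B, R)`: the constant words at distance less than `B` from `R`. -/
def base : Expr :=
  caseOf (var 0) nil <| caseOf (var 1) nil <|
  letIn (call 4 (cons (var 2) (cons nil nil))) <|
  letIn (call 5 (cons nil (cons (call 2 (cons (var 3) (cons (var 0) (cons (var 2) (var 1)))))
    (cons (var 0) nil)))) <|
  letIn (call 4 (cons (var 4) nil)) <|
  call 5 (cons nil (cons (call 2 (cons (var 5) (cons (var 0) (cons (var 4) (var 3)))))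
    (cons (var 0) (var 1))))

/-- Input `(G, p, f)`: the word with halves `p`, `f` in the order that `G` prescribes. -/
def order : Expr :=
  caseOf (var 0) nil <| caseOf (var 1) nil <|
  caseOf (var 2) (cons (var 0) (var 1)) (cons (var 3) (var 2))

/-- Input `((n, S, T, B, G), p, Q, l)`: the extensions of `p` by `Q`, followed by the list `l`. -/
def extend : Expr :=
  caseOf (var 0) nil <| caseOf (var 1) nil <| caseOf (var 1) nil <|
  caseOf (var 0) (var 1) <|
  caseOf (var 6) nil <| caseOf (var 1) nil <| caseOf (var 1) nil <| caseOf (var 1) nil <|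
  letIn (call 8 (cons (var 14) (cons (var 12) (cons (var 9) (var 11))))) <|
  letIn (call 1 (cons (var 7) (cons (var 13) (var 9)))) <|
  letIn (call 2 (cons (var 8) (cons (var 0) (cons (var 4)
    (call 2 (cons (var 8) (cons (var 14) (cons (var 6) (var 2))))))))) <|
  letIn (call 2 (cons (var 9) (cons (var 1) (cons (var 5) (var 4))))) <|
  call 5 (cons (var 0) (cons (var 1) (cons (call 7 (cons (var 5) (cons (var 16) (var 2))))
    (var 3))))

/-- Input `(((n, S, T, B, G), d), L, l)`: the extensions of all `p ∈ L`, followed by `l`. -/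
def extendAll : Expr :=
  caseOf (var 0) nil <| caseOf (var 1) nil <| caseOf (var 0) (var 1) <|
  letIn (call 9 (cons (var 4) (cons (var 1) (var 3)))) <|
  caseOf (var 5) nil <| caseOf (var 0) nil <| caseOf (var 1) nil <| caseOf (var 1) nil <|
  caseOf (var 1) nil <|
  call 8 (cons (var 8) (cons (var 11)
    (cons (call 10 (cons (var 6) (cons (var 9) (cons (var 0)
      (call 1 (cons (var 6) (cons (var 2) (var 11)))))))) (var 10))))

/-- Input `(n, d, B, R)`: the list `decode n d B R`. -/
def dec : Expr :=
  caseOf (var 0) nil <| caseOf (var 1) nil <| caseOf (var 1) nil <|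
  caseOf (var 4) (call 6 (cons (var 4) (cons (var 0) (var 1)))) <|
  caseOf (var 4) (call 6 (cons (var 6) (cons (var 2) (var 3)))) <|
  caseOf (var 5) nil <|
  letIn (call 3 (var 6)) <|
  letIn (call 9 (cons
    (cons (cons (var 6) (cons (var 2) (cons (var 1) (cons (var 7) (var 0))))) (var 4))
    (cons (call 10 (cons (var 6) (cons (var 9) (cons (var 0) (var 2))))) nil))) <|
  call 9 (cons
    (cons (cons (var 7) (cons (var 2) (cons (var 3) (cons (var 8) nil)))) (var 5))
    (cons (call 10 (cons (var 7) (cons (var 10) (cons (var 1) (var 2))))) (var 0)))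

end Prog

/-- The list-decoding program. -/
def program : Program :=
  [Prog.main, Prog.add, Prog.sub, Prog.up, Prog.const, Prog.select, Prog.base, Prog.order,
    Prog.extend, Prog.extendAll, Prog.dec]

/-! ## Running times -/

/-- Evaluation in `program` within `T` steps. -/
def EvalLe (env : List Data) (e : Expr) (v : Data) (T : ℕ) : Prop :=
  ∃ t, Eval program env e v t ∧ t ≤ T

/-- Evaluation of the body of function number `f` within `T` steps. -/
def CallLe (f : ℕ) (v w : Data) (T : ℕ) : Prop :=
  ∃ body, program[f]? = some body ∧ EvalLe [v] body w T

namespace EvalLe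

variable {env : List Data} {e e₁ e₂ : Expr} {v w a b v₁ v₂ : Data} {i f T T' T₁ T₂ : ℕ}

theorem mono (h : EvalLe env e v T) (hT : T ≤ T') : EvalLe env e v T' :=
  let ⟨t, ht, hle⟩ := h; ⟨t, ht, hle.trans hT⟩

theorem var (h : env[i]? = some v) : EvalLe env (.var i) v 1 := ⟨1, .var h, le_rfl⟩

theorem nil : EvalLe env .nil .nil 1 := ⟨1, .nil, le_rfl⟩

theorem cons (h₁ : EvalLe env e₁ v₁ T₁) (h₂ : EvalLe env e₂ v₂ T₂) :
    EvalLe env (.cons e₁ e₂) (.cons v₁ v₂) (T₁ + T₂ + 1) :=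
  let ⟨_, k₁, l₁⟩ := h₁; let ⟨_, k₂, l₂⟩ := h₂
  ⟨_, .cons k₁ k₂, Nat.add_le_add_right (Nat.add_le_add l₁ l₂) 1⟩

theorem letIn (h₁ : EvalLe env e₁ v₁ T₁) (h₂ : EvalLe (v₁ :: env) e₂ v₂ T₂) :
    EvalLe env (.letIn e₁ e₂) v₂ (T₁ + T₂ + 1) :=
  let ⟨_, k₁, l₁⟩ := h₁; let ⟨_, k₂, l₂⟩ := h₂
  ⟨_, .letIn k₁ k₂, Nat.add_le_add_right (Nat.add_le_add l₁ l₂) 1⟩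

theorem caseNil (h : env[i]? = some .nil) (h₁ : EvalLe env e₁ v T) :
    EvalLe env (.caseOf (.var i) e₁ e₂) v (T + 2) :=
  let ⟨_, k, l⟩ := h₁
  ⟨_, .caseNil (.var h) k, by omega⟩

theorem caseCons (h : env[i]? = some (.cons a b)) (h₂ : EvalLe (a :: b :: env) e₂ v T) :
    EvalLe env (.caseOf (.var i) e₁ e₂) v (T + 2) :=
  let ⟨_, k, l⟩ := h₂
  ⟨_, .caseCons (.var h) k, by omega⟩

theorem call (h : EvalLe env e v T₁) (hc : CallLe f v w T₂) :
    EvalLe env (.call f e) w (T₁ + T₂ + 1) :=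
  let ⟨_, k, l⟩ := h; let ⟨_, hf, _, k', l'⟩ := hc
  ⟨_, .call k hf k', Nat.add_le_add_right (Nat.add_le_add l l') 1⟩

end EvalLe

/-! ### Correctness and time of the subroutines. -/

theorem encodeBit_zero : encodeBit 0 = .nil := rfl

theorem encodeBit_one : encodeBit 1 = .cons .nil .nil := rfl

theorem encodeWord_zero (f : Word 0) : encodeWord f = encodeBit (f Fin.elim0) := rfl

/-- The subtracted `40` absorbs the overhead at each node: `2 * (80 * 2 ^ n - 40) + 40 = 80 * 2 ^ (n
+ 1) - 40`. -/
theorem callLe_add {n : ℕ} (u v : Word n) :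
    CallLe 1 (.cons (encodeNat n) (.cons (encodeWord u) (encodeWord v))) (encodeWord (u + v))
      (80 * 2 ^ n - 40) := by
  induction n with
  | zero =>
    refine ⟨_, rfl, ?_⟩
    unfold Prog.add
    simp only [encodeWord_zero, Pi.add_apply, encodeNat]
    rcases zmod_two_cases (u Fin.elim0) with hu | hu <;>
    rcases zmod_two_cases (v Fin.elim0) with hv | hv <;>
    rw [hu, hv] <;>
    simp only [zmod_two_add_self, add_zero, zero_add, encodeBit_zero, encodeBit_one] <;>
    refine EvalLe.mono (T := 40) ?_ (by omega) <;>
    repeat first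
      | exact (EvalLe.var rfl).mono (by omega)
      | exact EvalLe.nil.mono (by omega)
      | refine EvalLe.caseCons rfl ?_
      | refine EvalLe.caseNil rfl ?_
  | succ n ih =>
    simp only [encodeWord_succ, half_add, encodeNat]
    refine ⟨_, rfl, ?_⟩
    unfold Prog.add
    refine (EvalLe.caseCons rfl <| .caseCons rfl <| .caseCons rfl <| .caseCons rfl <|
      .caseCons rfl <| .cons
        (.call (.cons (.var rfl) (.cons (.var rfl) (.var rfl))) (ih _ _))
        (.call (.cons (.var rfl) (.cons (.var rfl) (.var rfl))) (ih _ _))).mono ?_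
    have := Nat.one_le_two_pow (n := n)
    rw [pow_succ]
    omega

/-- Truncated subtraction allows the halves to be processed one after the other, and the result is
nonzero exactly when the distance is below `B`, which is the test that the decoder needs. -/
theorem callLe_sub {n : ℕ} (u v : Word n) (B : ℕ) :
    CallLe 2 (.cons (encodeNat n) (.cons (encodeWord u) (.cons (encodeWord v) (encodeNat B))))
      (encodeNat (B - hammingDist u v)) (80 * 2 ^ n - 40) := by
  induction n generalizing B with
  | zero =>
    refine ⟨_, rfl, ?_⟩
    unfold Prog.sub
    simp only [encodeWord_zero, encodeNat, hammingDist_zero_dim]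
    rcases zmod_two_cases (u Fin.elim0) with hu | hu <;>
    rcases zmod_two_cases (v Fin.elim0) with hv | hv <;>
    rcases B with _ | B <;>
    rw [hu, hv] <;>
    simp only [encodeBit_zero, encodeBit_one, if_true, zero_ne_one, one_ne_zero, if_false,
      Nat.sub_zero, Nat.zero_sub, Nat.add_sub_cancel, encodeNat] <;>
    refine EvalLe.mono (T := 40) ?_ (by omega) <;>
    repeat first
      | exact (EvalLe.var rfl).mono (by omega)
      | exact EvalLe.nil.mono (by omega)
      | refine EvalLe.caseCons rfl ?_
      | refine EvalLe.caseNil rfl ?_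
  | succ n ih =>
    rw [hammingDist_succ, ← Nat.sub_sub]
    simp only [encodeWord_succ, encodeNat]
    refine ⟨_, rfl, ?_⟩
    unfold Prog.sub
    refine (EvalLe.caseCons rfl <| .caseCons rfl <| .caseCons rfl <| .caseCons rfl <|
      .caseCons rfl <| .caseCons rfl <| .call (.cons (.var rfl) (.cons (.var rfl) (.cons (.var rfl)
        (.call (.cons (.var rfl) (.cons (.var rfl) (.cons (.var rfl) (.var rfl)))) (ih _ _ _)))))
        (ih _ _ _)).mono ?_
    have := Nat.one_le_two_pow (n := n)
    rw [pow_succ]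
    omega

theorem callLe_up (B : ℕ) : CallLe 3 (encodeNat B) (encodeNat ((B + 1) / 2)) (10 * B + 10) := by
  refine ⟨_, rfl, ?_⟩
  unfold Prog.up
  induction B using Nat.twoStepInduction with
  | zero => exact (EvalLe.caseNil rfl .nil).mono (by omega)
  | one => exact (EvalLe.caseCons rfl (.caseNil rfl (.cons .nil .nil))).mono (by omega)
  | more B ih _ =>
    rw [show (B + 2 + 1) / 2 = (B + 1) / 2 + 1 by omega]
    simp only [encodeNat]
    exact (EvalLe.caseCons rfl (.caseCons rfl (.cons .nil
      (.call (.var rfl) ⟨_, rfl, ih⟩)))).mono (by omega)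

theorem callLe_const (n : ℕ) (b : ZMod 2) :
    CallLe 4 (.cons (encodeNat n) (encodeBit b)) (encodeWord (fun _ => b : Word n))
      (80 * 2 ^ n - 40) := by
  refine ⟨_, rfl, ?_⟩
  unfold Prog.const
  induction n with
  | zero => exact (EvalLe.caseCons rfl (.caseNil rfl (.var rfl))).mono (by omega)
  | succ n ih =>
    rw [encodeWord_succ]
    simp only [encodeNat]
    refine (EvalLe.caseCons rfl (.caseCons rfl (.letIn
      (.call (.cons (.var rfl) (.var rfl)) ⟨_, rfl, ih⟩) (.cons (.var rfl) (.var rfl))))).mono ?_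
    have := Nat.one_le_two_pow (n := n)
    rw [pow_succ]
    omega

theorem callLe_select (g s : ℕ) (w : Data) (l : List Data) :
    CallLe 5 (.cons (encodeNat g) (.cons (encodeNat s) (.cons w (encodeList l))))
      (encodeList (if g = 0 ∧ s ≠ 0 then w :: l else l)) 20 := by
  refine ⟨_, rfl, ?_⟩
  unfold Prog.select
  rcases g with _ | g
  · rcases s with _ | s
    · rw [if_neg (by simp)]
      exact (EvalLe.caseCons rfl (.caseCons rfl (.caseCons rfl (.caseNil rfl
        (.caseNil rfl (.var rfl)))))).mono (by omega)
    · rw [if_pos (by simp)]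
      exact (EvalLe.caseCons rfl (.caseCons rfl (.caseCons rfl (.caseNil rfl
        (.caseCons rfl (.cons (.var rfl) (.var rfl))))))).mono (by omega)
  · rw [if_neg (by simp)]
    exact (EvalLe.caseCons rfl (.caseCons rfl (.caseCons rfl (.caseCons rfl
      (.var rfl))))).mono (by omega)

theorem callLe_order {n : ℕ} (G : ℕ) (p f : Word n) :
    CallLe 7 (.cons (encodeNat G) (.cons (encodeWord p) (encodeWord f)))
      (encodeWord (pairUp G p f)) 20 := by
  refine ⟨_, rfl, ?_⟩
  unfold Prog.order
  rcases G with _ | G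
  · rw [pairUp, if_pos rfl, encodeWord_join]
    exact (EvalLe.caseCons rfl (.caseCons rfl (.caseNil rfl
      (.cons (.var rfl) (.var rfl))))).mono (by omega)
  · rw [pairUp, if_neg (Nat.succ_ne_zero G), encodeWord_join]
    exact (EvalLe.caseCons rfl (.caseCons rfl (.caseCons rfl
      (.cons (.var rfl) (.var rfl))))).mono (by omega)

theorem callLe_base {n : ℕ} (B : ℕ) (R : Word n) :
    CallLe 6 (.cons (encodeNat n) (.cons (encodeNat B) (encodeWord R)))
      (encodeList ((constants B R).map encodeWord)) (500 * 2 ^ n) := by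
  refine ⟨_, rfl, ?_⟩
  unfold Prog.base
  set c0 : Word n := fun _ => 0
  set c1 : Word n := fun _ => 1
  have h1 := callLe_select 0 (B - hammingDist c1 R) (encodeWord c1) []
  have h0 := callLe_select 0 (B - hammingDist c0 R) (encodeWord c0)
    (if 0 = 0 ∧ B - hammingDist c1 R ≠ 0 then [encodeWord c1] else [])
  have e : (constants B R).map encodeWord
      = if 0 = 0 ∧ B - hammingDist c0 R ≠ 0 then encodeWord c0 ::
          (if 0 = 0 ∧ B - hammingDist c1 R ≠ 0 then [encodeWord c1] else [])
        else (if 0 = 0 ∧ B - hammingDist c1 R ≠ 0 then [encodeWord c1] else []) := by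
    simp only [constants, List.filter_cons, List.filter_nil, decide_eq_true_eq, true_and,
      Nat.sub_ne_zero_iff_lt]
    split_ifs <;> rfl
  rw [e]
  refine (EvalLe.caseCons rfl <| .caseCons rfl <|
    .letIn (.call (.cons (.var rfl) (.cons .nil .nil)) (callLe_const n 1)) <|
    .letIn (.call (.cons .nil (.cons (.call (.cons (.var rfl) (.cons (.var rfl) (.cons (.var rfl)
      (.var rfl)))) (callLe_sub _ _ _)) (.cons (.var rfl) .nil))) h1) <|
    .letIn (.call (.cons (.var rfl) .nil) (callLe_const n 0)) <|
    .call (.cons .nil (.cons (.call (.cons (.var rfl) (.cons (.var rfl) (.cons (.var rfl)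
      (.var rfl)))) (callLe_sub _ _ _)) (.cons (.var rfl) (.var rfl)))) h0).mono ?_
  have := Nat.one_le_two_pow (n := n)
  omega

/-- The encoding of the parameters of `extensions`. -/
def encodeContext {n : ℕ} (S T : Word n) (B G : ℕ) : Data :=
  .cons (encodeNat n) (.cons (encodeWord S) (.cons (encodeWord T)
    (.cons (encodeNat B) (encodeNat G))))

theorem extensions_cons {n : ℕ} (S T : Word n) (B G : ℕ) (p q : Word n) (Q : List (Word n)) :
    extensions S T B G p (q :: Q) =
      if G - hammingDist (p + q) T = 0 ∧ B - hammingDist p S - hammingDist (p + q) T ≠ 0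
      then pairUp G p (p + q) :: extensions S T B G p Q else extensions S T B G p Q := by
  have : (G - hammingDist (p + q) T = 0 ∧ B - hammingDist p S - hammingDist (p + q) T ≠ 0) ↔
      (G ≤ hammingDist (p + q) T ∧ hammingDist p S + hammingDist (p + q) T < B) := by
    rw [Nat.sub_sub, Nat.sub_ne_zero_iff_lt, Nat.sub_eq_zero_iff_le]
  simp only [this, extensions, List.filter_cons, decide_eq_true_eq]
  split_ifs <;> rfl

theorem callLe_extend {n : ℕ} (S T : Word n) (B G : ℕ) (p : Word n) (Q : List (Word n))
    (l : List Data) :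
    CallLe 8 (.cons (encodeContext S T B G)
        (.cons (encodeWord p) (.cons (encodeList (Q.map encodeWord)) (encodeList l))))
      (encodeList ((extensions S T B G p Q).map encodeWord ++ l))
      ((Q.length + 1) * (500 * 2 ^ n)) := by
  refine ⟨_, rfl, ?_⟩
  unfold Prog.extend
  have hn := Nat.one_le_two_pow (n := n)
  induction Q with
  | nil =>
    refine (EvalLe.caseCons rfl <| .caseCons rfl <| .caseCons rfl <| .caseNil rfl <|
      .var rfl).mono ?_
    simp only [List.length_nil]
    omega
  | cons q Q ih =>
    have e : (extensions S T B G p (q :: Q)).map encodeWord ++ l =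
        if G - hammingDist (p + q) T = 0 ∧ B - hammingDist p S - hammingDist (p + q) T ≠ 0
        then encodeWord (pairUp G p (p + q)) :: ((extensions S T B G p Q).map encodeWord ++ l)
        else (extensions S T B G p Q).map encodeWord ++ l := by
      rw [extensions_cons]
      split_ifs <;> rfl
    rw [e]
    simp only [List.map_cons, encodeList]
    refine (EvalLe.caseCons rfl <| .caseCons rfl <| .caseCons rfl <| .caseCons rfl <|
      .caseCons rfl <| .caseCons rfl <| .caseCons rfl <| .caseCons rfl <|
      .letIn (.call (.cons (.var rfl) (.cons (.var rfl) (.cons (.var rfl) (.var rfl))))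
        ⟨_, rfl, ih⟩) <|
      .letIn (.call (.cons (.var rfl) (.cons (.var rfl) (.var rfl))) (callLe_add _ _)) <|
      .letIn (.call (.cons (.var rfl) (.cons (.var rfl) (.cons (.var rfl) (.call (.cons (.var rfl)
        (.cons (.var rfl) (.cons (.var rfl) (.var rfl)))) (callLe_sub _ _ _))))) (callLe_sub _ _ _)) <|
      .letIn (.call (.cons (.var rfl) (.cons (.var rfl) (.cons (.var rfl) (.var rfl))))
        (callLe_sub _ _ _)) <|
      .call (.cons (.var rfl) (.cons (.var rfl) (.cons (.call (.cons (.var rfl) (.cons (.var rfl)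
        (.var rfl))) (callLe_order _ _ _)) (.var rfl)))) (callLe_select _ _ _ _)).mono ?_
    rw [List.length_cons, Nat.succ_mul (Q.length + 1)]
    generalize (Q.length + 1) * (500 * 2 ^ n) = X
    omega

/-- The mutual recursion with the decoder is cut by taking its behaviour in dimension `n` as the
hypothesis `hD`; the induction in `callLe_dec` supplies it. -/
theorem callLe_extendAll {n d B D M : ℕ} (S T : Word n) (G : ℕ)
    (hD : ∀ R : Word n, CallLe 10
      (.cons (encodeNat n) (.cons (encodeNat d) (.cons (encodeNat B) (encodeWord R))))
      (encodeList ((decode n d B R).map encodeWord)) D)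
    (hM : ∀ R : Word n, (decode n d B R).length ≤ M) (L : List (Word n)) (l : List Data) :
    CallLe 9 (.cons (.cons (encodeContext S T B G) (encodeNat d))
        (.cons (encodeList (L.map encodeWord)) (encodeList l)))
      (encodeList ((L.flatMap fun p =>
        extensions S T B G p (decode n d B (T + p))).map encodeWord ++ l))
      ((L.length + 1) * (D + (M + 2) * (500 * 2 ^ n))) := by
  refine ⟨_, rfl, ?_⟩
  unfold Prog.extendAll
  have hn := Nat.one_le_two_pow (n := n)
  induction L with
  | nil =>
    refine (EvalLe.caseCons rfl <| .caseCons rfl <| .caseNil rfl <| .var rfl).mono ?_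
    simp only [List.length_nil]
    nlinarith [Nat.zero_le (M * (500 * 2 ^ n))]
  | cons p L ih =>
    rw [List.flatMap_cons, List.map_append, List.append_assoc]
    simp only [List.map_cons, encodeList]
    refine (EvalLe.caseCons rfl <| .caseCons rfl <| .caseCons rfl <|
      .letIn (.call (.cons (.var rfl) (.cons (.var rfl) (.var rfl))) ⟨_, rfl, ih⟩) <|
      .caseCons rfl <| .caseCons rfl <| .caseCons rfl <| .caseCons rfl <| .caseCons rfl <|
      .call (.cons (.var rfl) (.cons (.var rfl) (.cons (.call (.cons (.var rfl) (.cons (.var rfl)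
        (.cons (.var rfl) (.call (.cons (.var rfl) (.cons (.var rfl) (.var rfl)))
          (callLe_add _ _))))) (hD _)) (.var rfl)))) (callLe_extend _ _ _ _ _ _ _)).mono ?_
    have h1 := Nat.mul_le_mul_right (500 * 2 ^ n) (Nat.succ_le_succ (hM (T + p)))
    rw [List.length_cons, Nat.succ_mul (L.length + 1), Nat.succ_mul (M + 1)]
    generalize (L.length + 1) * (D + ((M + 1) * (500 * 2 ^ n) + 500 * 2 ^ n)) = X
    simp only [Nat.succ_eq_add_one] at h1
    omega

/-! ### Running time of the decoder. -/

theorem RadiusBound.half {c : ℝ} {n d B : ℕ} (h : RadiusBound c (n + 1) d B) :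
    RadiusBound c n d ((B + 1) / 2) := by
  intro k hk
  have := h (2 * k) (by omega)
  push_cast at this
  rw [pow_succ 2 n] at this
  linarith

theorem RadiusBound.pred {c : ℝ} {n d B : ℕ} (h : RadiusBound c (n + 1) (d + 1) B) :
    RadiusBound c n d B := by
  intro k hk
  have := h k hk
  rw [pow_succ, pow_succ] at this
  linarith

theorem base_time_le {b M : ℕ} (hM : 1 ≤ M) (n d : ℕ) :
    20 + 500 * 2 ^ n ≤ 1000 * (b + 1) * (4 * M ^ 2) ^ (d + 1) * 8 ^ n := by
  have h1 : 1 ≤ (4 * M ^ 2) ^ (d + 1) := Nat.one_le_pow _ _ (by positivity)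
  have h2 : 2 ^ n ≤ 8 ^ n := Nat.pow_le_pow_left (by omega) n
  have h3 := Nat.one_le_two_pow (n := n)
  calc 20 + 500 * 2 ^ n ≤ 1000 * 1 * 1 * 2 ^ n := by omega
    _ ≤ _ := by gcongr; omega

/-- Here `Y` stands for the time in degree `d` and `Y * (4 * M ^ 2)` for that in degree `d + 1`,
both in dimension `n`. The two calls of degree `d + 1` cost twice the latter, each loop at most `3 /
2` of it, and the remaining terms at most one more; `8` leaves slack. -/
theorem step_time_le {b B M n L₀ L₁ X Y : ℕ} (hM : 1 ≤ M) (hB : B ≤ b) (h₀ : L₀ ≤ M) (h₁ : L₁ ≤ M)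
    (hX : 8 ^ n * (b + 1) ≤ X) (hY : 1000 * X ≤ Y) :
    200 + 10 * B + 2 * (Y * (4 * M ^ 2)) + (L₀ + 1) * (Y + (M + 2) * (500 * 2 ^ n))
      + (L₁ + 1) * (Y + (M + 2) * (500 * 2 ^ n)) ≤ 8 * (Y * (4 * M ^ 2)) := by
  have hMM : M ≤ M ^ 2 := Nat.le_self_pow two_ne_zero M
  have hZ : 1 ≤ 4 * M ^ 2 := by omega
  have hn : 2 ^ n ≤ X := (Nat.pow_le_pow_left (by omega) n).trans
    ((Nat.le_mul_of_pos_right _ (Nat.succ_pos b)).trans hX)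
  have hb : b + 1 ≤ X := (Nat.le_mul_of_pos_left _ (by positivity)).trans hX
  have loop : ∀ L, L ≤ M →
      2 * ((L + 1) * (Y + (M + 2) * (500 * 2 ^ n))) ≤ 3 * (Y * (4 * M ^ 2)) := by
    intro L hL
    calc 2 * ((L + 1) * (Y + (M + 2) * (500 * 2 ^ n)))
        ≤ 2 * ((2 * M) * (Y + (3 * M) * (500 * X))) := by
          refine Nat.mul_le_mul_left 2 (Nat.mul_le_mul (by omega) (Nat.add_le_add_left
            (Nat.mul_le_mul (by omega) (Nat.mul_le_mul_left 500 hn)) Y))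
      _ = Y * (4 * M) + 6000 * X * M ^ 2 := by ring
      _ ≤ Y * (4 * M ^ 2) + 8 * Y * M ^ 2 := by
        exact Nat.add_le_add (Nat.mul_le_mul_left _ (Nat.mul_le_mul_left _ hMM))
          (Nat.mul_le_mul_right _ (by omega))
      _ = 3 * (Y * (4 * M ^ 2)) := by ring
  have h0 := loop L₀ h₀
  have h1 := loop L₁ h₁
  have hYZ : Y ≤ Y * (4 * M ^ 2) := Nat.le_mul_of_pos_right _ hZ
  omega

/-- `b`, `M` and `c` stay fixed through the recursion: `B` never grows, and `RadiusBound.half` and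
`RadiusBound.pred` keep `c`, so `hM` applies to every recursive call. -/
theorem callLe_dec {c : ℝ} {b M N D : ℕ} (hM1 : 1 ≤ M)
    (hM : ∀ n d B, n ≤ N → d ≤ D → RadiusBound c n d B →
      ∀ R : Word n, (decode n d B R).length ≤ M)
    (n d B : ℕ) (hn : n ≤ N) (hd : d ≤ D) (hB : RadiusBound c n d B) (hb : B ≤ b) (R : Word n) :
    CallLe 10 (.cons (encodeNat n) (.cons (encodeNat d) (.cons (encodeNat B) (encodeWord R))))
      (encodeList ((decode n d B R).map encodeWord))
      (1000 * (b + 1) * (4 * M ^ 2) ^ (d + 1) * 8 ^ n) := by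
  induction n generalizing d B with
  | zero =>
    refine ⟨_, rfl, ?_⟩
    unfold Prog.dec
    rw [decode]
    refine (EvalLe.caseCons rfl <| .caseCons rfl <| .caseCons rfl <| .caseNil rfl <|
      .call (.cons (.var rfl) (.cons (.var rfl) (.var rfl))) (callLe_base (n := 0) B R)).mono
      (le_trans ?_ (base_time_le hM1 0 d))
    omega
  | succ n ih =>
    cases d with
    | zero =>
      refine ⟨_, rfl, ?_⟩
      unfold Prog.dec
      rw [decode]
      refine (EvalLe.caseCons rfl <| .caseCons rfl <| .caseCons rfl <| .caseCons rfl <|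
        .caseNil rfl <| .call (.cons (.var rfl) (.cons (.var rfl) (.var rfl)))
          (callLe_base (n := n + 1) B R)).mono (le_trans ?_ (base_time_le hM1 (n + 1) 0))
      omega
    | succ d =>
      have hle : (B + 1) / 2 ≤ B := by omega
      have hn' : n ≤ N := by omega
      have hd' : d ≤ D := by omega
      have near : ∀ R, _ := fun R => ih (d + 1) ((B + 1) / 2) hn' hd hB.half (hle.trans hb) R
      have far : ∀ R, _ := fun R => ih d B hn' hd' hB.pred hb R
      have hlen := hM n d B hn' hd' hB.pred
      have hlen' := hM n (d + 1) ((B + 1) / 2) hn' hd hB.half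
      have loop1 := callLe_extendAll (half 1 R) (half 0 R) ((B + 1) / 2) far hlen
        (decode n (d + 1) ((B + 1) / 2) (half 1 R)) []
      have loop0 := callLe_extendAll (half 0 R) (half 1 R) 0 far hlen
        (decode n (d + 1) ((B + 1) / 2) (half 0 R))
        (((decode n (d + 1) ((B + 1) / 2) (half 1 R)).flatMap fun p =>
          extensions (half 1 R) (half 0 R) B ((B + 1) / 2) p
            (decode n d B (half 0 R + p))).map encodeWord)
      rw [List.append_nil] at loop1
      refine ⟨_, rfl, ?_⟩
      unfold Prog.dec
      rw [decode, List.map_append, encodeWord_succ]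
      refine (EvalLe.caseCons rfl <| .caseCons rfl <| .caseCons rfl <| .caseCons rfl <|
        .caseCons rfl <| .caseCons rfl <|
        .letIn (.call (.var rfl) (callLe_up B)) <|
        .letIn (.call (.cons (.cons (.cons (.var rfl) (.cons (.var rfl) (.cons (.var rfl)
            (.cons (.var rfl) (.var rfl))))) (.var rfl))
          (.cons (.call (.cons (.var rfl) (.cons (.var rfl) (.cons (.var rfl) (.var rfl))))
            (near _)) .nil)) loop1) <|
        .call (.cons (.cons (.cons (.var rfl) (.cons (.var rfl) (.cons (.var rfl)
            (.cons (.var rfl) .nil)))) (.var rfl))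
          (.cons (.call (.cons (.var rfl) (.cons (.var rfl) (.cons (.var rfl) (.var rfl))))
            (near _)) (.var rfl))) loop0).mono ?_
      have hX : 8 ^ n * (b + 1) ≤ 8 ^ n * (b + 1) * (4 * M ^ 2) ^ (d + 1) :=
        Nat.le_mul_of_pos_right _ (by positivity)
      have key := step_time_le (n := n) hM1 hb (hlen' (half 0 R)) (hlen' (half 1 R)) hX
        (le_refl (1000 * _))
      have e1 : 1000 * (8 ^ n * (b + 1) * (4 * M ^ 2) ^ (d + 1))
          = 1000 * (b + 1) * (4 * M ^ 2) ^ (d + 1) * 8 ^ n := by ring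
      have e2 : 1000 * (b + 1) * (4 * M ^ 2) ^ (d + 1 + 1) * 8 ^ n
          = 1000 * (b + 1) * (4 * M ^ 2) ^ (d + 1) * 8 ^ n * (4 * M ^ 2) := by ring
      have e3 : 1000 * (b + 1) * (4 * M ^ 2) ^ (d + 1 + 1) * 8 ^ (n + 1)
          = 8 * (1000 * (b + 1) * (4 * M ^ 2) ^ (d + 1) * 8 ^ n * (4 * M ^ 2)) := by ring
      rw [e1] at key
      rw [e3, e2]
      refine le_trans ?_ key
      omega

theorem callLe_main {n d A T : ℕ} {R : Word n} {y : Data}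
    (h : CallLe 10
      (.cons (encodeNat n) (.cons (encodeNat d) (.cons (encodeNat (A + 1)) (encodeWord R)))) y T) :
    CallLe 0 (.cons (encodeNat n) (.cons (encodeNat d) (.cons (encodeNat A) (encodeWord R)))) y
      (T + 20) := by
  refine ⟨_, rfl, ?_⟩
  unfold Prog.main
  exact (EvalLe.caseCons rfl <| .caseCons rfl <| .caseCons rfl <|
    .call (.cons (.var rfl) (.cons (.var rfl) (.cons (.cons .nil (.var rfl)) (.var rfl)))) h).mono
    (by omega)

/-! ### From relative radii to integer distances, and the final bound. -/

theorem mem_ball_iff {n d : ℕ} {α : ℝ} (hα : 0 ≤ α) {R p : Word n} :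
    p ∈ ball d R α ↔ IsLow n d p ∧ hammingDist p R < ⌊α * 2 ^ n⌋₊ + 1 := by
  rw [ball, Set.mem_ofPred_eq, mem_RM_iff, relDist, div_le_iff₀ (by positivity), Nat.lt_succ_iff,
    Nat.le_floor_iff (by positivity)]

theorem exists_length_decode_le {ℓ : ℕ} (hℓ : 1 ≤ ℓ) {η : ℝ} (h0 : 0 < η) (h1 : η ≤ 1) (D : ℕ) :
    ∃ C : ℕ, ∀ n d B, d ≤ D → RadiusBound ((1 - η) * 2 ^ ℓ) n d B →
      ∀ R, (decode n d B R).length ≤ 2 ^ (C * (n + 1) ^ ℓ) := by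
  choose C hC using exists_card_codeBall_le hℓ h0 h1
  refine ⟨(Finset.range (D + 1)).sup C, fun n d B hd hB R => ?_⟩
  refine (length_decode_le n d B R).trans ((hC d n B hB R).trans ?_)
  exact Nat.pow_le_pow_right two_pos (Nat.mul_le_mul_right _
    (Finset.le_sup (Finset.mem_range.2 (Nat.lt_succ_of_le hd))))

theorem total_time_le {n d b C ℓ : ℕ} (hℓ : 1 ≤ ℓ) (hb : b ≤ 2 ^ n + 1) :
    1000 * (b + 1) * (4 * (2 ^ (C * (n + 1) ^ ℓ)) ^ 2) ^ (d + 1) * 8 ^ n + 20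
      ≤ 2 ^ ((17 + (2 + 2 * C) * (d + 1)) * (n + 1) ^ ℓ) := by
  set m := (n + 1) ^ ℓ with hm
  have hnm : n + 1 ≤ m := Nat.le_self_pow (by omega) _
  have h2 : b + 1 ≤ 2 ^ (n + 2) := by
    have := Nat.one_le_two_pow (n := n)
    rw [pow_add]
    omega
  have h1 : 1 ≤ 2 ^ (n + 2) * (2 ^ ((2 + 2 * C * m) * (d + 1)) * 2 ^ (3 * n)) :=
    Nat.one_le_iff_ne_zero.2 (by positivity)
  have e4 : 4 * (2 ^ (C * m)) ^ 2 = 2 ^ (2 + 2 * C * m) := by ring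
  have e8 : 8 ^ n = 2 ^ (3 * n) := by rw [pow_mul]; norm_num
  rw [e4, e8, ← pow_mul]
  calc 1000 * (b + 1) * 2 ^ ((2 + 2 * C * m) * (d + 1)) * 2 ^ (3 * n) + 20
      ≤ 1000 * 2 ^ (n + 2) * 2 ^ ((2 + 2 * C * m) * (d + 1)) * 2 ^ (3 * n) + 20 := by gcongr
    _ = 1000 * (2 ^ (n + 2) * (2 ^ ((2 + 2 * C * m) * (d + 1)) * 2 ^ (3 * n))) + 20 := by ring
    _ ≤ 2 ^ 10 * (2 ^ (n + 2) * (2 ^ ((2 + 2 * C * m) * (d + 1)) * 2 ^ (3 * n))) := by omega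
    _ = 2 ^ (10 + (n + 2 + ((2 + 2 * C * m) * (d + 1) + 3 * n))) := by
      rw [← pow_add, ← pow_add, ← pow_add]
    _ ≤ _ := by
      refine Nat.pow_le_pow_right two_pos ?_
      have h3 : 2 * (d + 1) ≤ 2 * (d + 1) * m := Nat.le_mul_of_pos_right _ (by omega)
      calc 10 + (n + 2 + ((2 + 2 * C * m) * (d + 1) + 3 * n))
          = 12 + 4 * n + 2 * (d + 1) + 2 * C * (d + 1) * m := by ring
        _ ≤ 17 * m + 2 * (d + 1) * m + 2 * C * (d + 1) * m := by omega
        _ = _ := by ring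

theorem isTheta_const_mul_succ_pow {c : ℝ} (hc : c ≠ 0) (ℓ : ℕ) :
    (fun n : ℕ => c * ((n : ℝ) + 1) ^ ℓ) =Θ[atTop] fun n : ℕ => (n : ℝ) ^ ℓ := by
  refine IsTheta.const_mul_left hc (IsTheta.pow ⟨?_, ?_⟩ ℓ)
  · refine IsBigO.of_bound 2 ((eventually_ge_atTop 1).mono fun n hn => ?_)
    have : (1 : ℝ) ≤ n := by exact_mod_cast hn
    rw [Real.norm_of_nonneg (by positivity), Real.norm_of_nonneg (by positivity)]
    linarith
  · refine IsBigO.of_bound 1 (Eventually.of_forall fun n => ?_)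
    rw [Real.norm_of_nonneg (by positivity), Real.norm_of_nonneg (by positivity)]
    linarith

end ReedMuller

open ReedMuller in
theorem mainTheorem7 :
    ∃ (A : ReedMuller.Program) (P : Polynomial ℝ),
      ∀ (d ℓ : ℕ), 1 ≤ ℓ → ℓ + 1 ≤ d → ∀ ε : ℝ, 0 < ε →
        ∃ g : ℕ → ℝ, (g =Θ[atTop] fun n : ℕ => (n : ℝ) ^ ℓ) ∧
          ∀ (n : ℕ) (α : ℝ),
            α ∈ Set.Icc ((2 : ℝ) ^ ((ℓ : ℤ) - (d : ℤ) - 1)) ((2 : ℝ) ^ ((ℓ : ℤ) - (d : ℤ)) - ε) →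
            ∀ R : ReedMuller.Word n, ∃ t : ℕ,
              ReedMuller.ListDecodesIn A n d α R t ∧ (t : ℝ) ≤ P.eval ((2 : ℝ) ^ g n) := by
  refine ⟨program, Polynomial.X, fun d ℓ hℓ hd ε hε => ?_⟩
  -- This turns the absolute gap `ε` into a relative one: `2 ^ ℓ - ε * 2 ^ d ≤ (1 - η) * 2 ^ ℓ`. The
  -- minimum with `1` keeps `1 - η` nonnegative.
  set η : ℝ := min 1 (ε * 2 ^ d / 2 ^ ℓ)
  have h0 : 0 < η := lt_min one_pos (by positivity)
  obtain ⟨C, hC⟩ := exists_length_decode_le hℓ h0 (min_le_left _ _) d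
  set K := 17 + (2 + 2 * C) * (d + 1)
  have hK : ((K : ℕ) : ℝ) ≠ 0 := by
    rw [Nat.cast_ne_zero]
    omega
  refine ⟨fun n => K * ((n : ℝ) + 1) ^ ℓ, isTheta_const_mul_succ_pow hK ℓ, ?_⟩
  rintro n α ⟨hα₁, hα₂⟩ R
  have hα0 : 0 ≤ α := le_trans (by positivity) hα₁
  have hz : (2 : ℝ) ^ ((ℓ : ℤ) - (d : ℤ)) = 2 ^ ℓ / 2 ^ d := by
    rw [zpow_sub₀ two_ne_zero, zpow_natCast, zpow_natCast]
  rw [hz] at hα₂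
  set A := ⌊α * 2 ^ n⌋₊
  have hA : (A : ℝ) ≤ α * 2 ^ n := Nat.floor_le (by positivity)
  have hradius : RadiusBound ((1 - η) * 2 ^ ℓ) n d (A + 1) := by
    intro h hh
    have h1 : (h : ℝ) ≤ A := by exact_mod_cast Nat.lt_succ_iff.1 hh
    have h2 : η * 2 ^ ℓ ≤ ε * 2 ^ d :=
      (le_div_iff₀ (by positivity)).1 (min_le_right _ _)
    calc (h : ℝ) * 2 ^ d ≤ ((2 ^ ℓ / 2 ^ d - ε) * 2 ^ n) * 2 ^ d := by
          gcongr
          exact h1.trans (hA.trans (by gcongr))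
      _ = (2 ^ ℓ - ε * 2 ^ d) * 2 ^ n := by field_simp
      _ ≤ (2 ^ ℓ - η * 2 ^ ℓ) * 2 ^ n := by gcongr
      _ = (1 - η) * 2 ^ ℓ * 2 ^ n := by ring
  -- As `ℓ < d`, the relative radius is below `1`, so the parameter `b` adds only a factor `2 ^
  -- O(n)` to the time.
  have hb : A + 1 ≤ 2 ^ n + 1 := by
    have h1 : (2 : ℝ) ^ ℓ / 2 ^ d ≤ 1 :=
      (div_le_one (by positivity)).2 (pow_le_pow_right₀ one_le_two (by omega))
    have h2 : (A : ℝ) ≤ (2 ^ n : ℕ) := by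
      refine hA.trans ?_
      push_cast
      exact mul_le_of_le_one_left (by positivity) (by linarith)
    exact Nat.succ_le_succ (by exact_mod_cast h2)
  obtain ⟨body, hbody, t, hev, ht⟩ := callLe_main
    (callLe_dec (N := n) (D := d) (M := 2 ^ (C * (n + 1) ^ ℓ)) Nat.one_le_two_pow
      (fun n' d' B hn' hd' hB R => (hC n' d' B hd' hB R).trans (by gcongr; exact one_le_two))
      n d (A + 1) le_rfl le_rfl hradius le_rfl R)
  refine ⟨t, ⟨decode n d (A + 1) R, fun p => mem_decode.trans (mem_ball_iff hα0).symm,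
    body, hbody, hev⟩, ?_⟩
  have htot := ht.trans (total_time_le hℓ hb)
  have hg : (K : ℝ) * ((n : ℝ) + 1) ^ ℓ = ((K * (n + 1) ^ ℓ : ℕ) : ℝ) := by push_cast; rfl
  rw [Polynomial.eval_X]
  beta_reduce
  rw [hg, Real.rpow_natCast]
  exact_mod_cast htot
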